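/- Let $\Sigma$ be a nonsingular complete fan in $N=\mathbb{Z}^5$ such that the associated smooth complete toric variety $X=X_\Sigma$ is Fano (that is, $-K_X$ is ample) and has index $2$ (that is, $2$ is the largest integer $m\ge 1$ such that $-K_X=mH$ in $\mathrm{Pic}(X)$ for some $H$). Let $G(\Sigma)$ be the set of primitive generators of the one-dimensional cones of $\Sigma$. A subset $P\subset G(\Sigma)$ is a primitive collection if $P$ does not generate a cone of $\Sigma$ but every proper subset of $P$ does. Its primitive relation is the unique equality $\sum_{x\in P}x=b_1y_1+\cdots+b_ny_n$ with $n\ge 0$, $b_1,\dots,b_n$ positive integers, and $y_1,\dots,y_n\in G(\Sigma)$ the distinct generators of a cone of $\Sigma$. This relation defines a class $r(P)\in A_1(X)\simeq\{(c_x)\in\mathbb{Z}^{G(\Sigma)} : \sum_x c_x x=0\}$, and $P$ (or its primitive relation) is called extremal if $r(P)$ lies in an extremal ray of the Mori cone $\mathrm{NE}(X)\subset A_1(X)\otimes\mathbb{R}$. Then there is an extremal primitive collection of $\Sigma$ whose primitive relation is neither of the form $x_1+x_2+x_3+x_4=y_1+y_2$ (with distinct $x_i$ and $y_1\neq y_2$)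 nor of the form $x_1+x_2+x_3=y_1$ (with distinct $x_i$). In particular, $X$ has a primitive relation that is of neither of these two forms. -/

import Mathlib

/-- The embedding of the lattice `N = ℤ^d` into `N_ℝ = ℝ^d`. -/
def latticeToReal {d : ℕ} (v : Fin d → ℤ) : Fin d → ℝ := fun i => (v i : ℝ)

/-- The closed convex cone in `N_ℝ = ℝ^d` generated by a finite set of lattice vectors. -/
noncomputable def latticeCone {d : ℕ} (S : Finset (Fin d → ℤ)) : PointedCone ℝ (Fin d → ℝ) :=
  PointedCone.hull ℝ (latticeToReal '' (S : Set (Fin d → ℤ)))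

/-- A nonsingular complete fan `Σ` in `N = ℤ^d`.

A nonsingular cone is generated by part of a `ℤ`-basis of `N`, and it determines this generating set
(the primitive generators of its one-dimensional faces); its faces are exactly the cones generated
by the subsets.  So a nonsingular fan is recorded by the finite set `cones` of the generating sets
of its cones.  The fields say: the zero cone is in the fan, every face of a cone of the fan is in
the fan, every cone is nonsingular, two cones intersect in a common face, and the cones
cover `N_ℝ`. -/
structure SmoothCompleteFan (d : ℕ) where
  /-- The generating sets of the cones of the fan. -/
  cones : Finset (Finset (Fin d → ℤ))
  empty_mem : ∅ ∈ cones
  face_mem : ∀ S ∈ cones, ∀ T, T ⊆ S → T ∈ cones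
  nonsingular : ∀ S ∈ cones, ∃ b : Module.Basis (Fin d) ℤ (Fin d → ℤ),
    (S : Set (Fin d → ℤ)) ⊆ Set.range b
  inter_eq : ∀ S ∈ cones, ∀ T ∈ cones,
    latticeCone S ⊓ latticeCone T = latticeCone (S ∩ T)
  complete : ∀ v : Fin d → ℝ, ∃ S ∈ cones, v ∈ latticeCone S

namespace SmoothCompleteFan

variable {d : ℕ} (F : SmoothCompleteFan d)

/-- `G(Σ)`: the set of primitive generators of the one-dimensional cones of the fan. -/
def gens : Finset (Fin d → ℤ) := (F.cones.biUnion id).filter fun x => {x} ∈ F.cones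

/-! ### Divisors, the Picard group, Fano, index -/

/-- The map `M = Hom(N, ℤ) → ℤ^{G(Σ)}`, `m ↦ (⟨m, x⟩)_x`, sending a character to the torus
invariant principal divisor it defines. -/
def principalDivisor : Module.Dual ℤ (Fin d → ℤ) →ₗ[ℤ] (F.gens → ℤ) where
  toFun m := fun x => m x.1
  map_add' _ _ := rfl
  map_smul' _ _ := rfl

/-- `Pic(X) = ℤ^{G(Σ)} / M`. -/
abbrev Pic : Type := (F.gens → ℤ) ⧸ LinearMap.range F.principalDivisor

/-- The torus invariant anticanonical divisor `-K_X = ∑_{x ∈ G(Σ)} D_x`. -/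
def antiCanonical : F.gens → ℤ := fun _ => 1

/-- The torus invariant divisor `∑ a_x D_x` is ample: its support function is strictly convex.
That is, for every maximal cone `S` there is `m_S ∈ M` with `⟨m_S, x⟩ = -a_x` for the generators `x`
of `S` and `⟨m_S, x⟩ > -a_x` for all other `x ∈ G(Σ)`. -/
def IsAmple (a : F.gens → ℤ) : Prop :=
  ∀ S ∈ F.cones, S.card = d → ∃ m : Module.Dual ℤ (Fin d → ℤ),
    ∀ x : F.gens, (x.1 ∈ S → m x.1 = -a x) ∧ (x.1 ∉ S → -a x < m x.1)

/-- `X` is Fano: `-K_X` is ample. -/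
def IsFano : Prop := F.IsAmple F.antiCanonical

/-- `X` has index `i`: `i` is the largest integer `m ≥ 1` such that `-K_X = m H` in `Pic(X)`
for some `H`. -/
def HasIndex (i : ℕ) : Prop :=
  IsGreatest {m : ℕ | 1 ≤ m ∧ ∃ H : F.Pic, (Submodule.Quotient.mk F.antiCanonical : F.Pic) = m • H} i

/-! ### Primitive collections and primitive relations -/

/-- `P ⊆ G(Σ)` is a primitive collection: `P` does not generate a cone of the fan, but every
proper subset of `P` does. -/
def IsPrimitiveCollection (P : Finset (Fin d → ℤ)) : Prop :=
  P ⊆ F.gens ∧ P ∉ F.cones ∧ ∀ Q, Q ⊂ P → Q ∈ F.cones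

/-- `∑_{x ∈ P} x = ∑_y b_y y` is the primitive relation of the primitive collection `P`.
The support of `b` (where `b_y > 0`) generates a cone of the fan; it is the cone `σ(P)` that contains
`∑_{x ∈ P} x` in its relative interior. -/
def IsPrimitiveRelation (P : Finset (Fin d → ℤ)) (b : (Fin d → ℤ) →₀ ℕ) : Prop :=
  F.IsPrimitiveCollection P ∧ b.support ∈ F.cones ∧
    ∑ x ∈ P, x = ∑ y ∈ b.support, b y • y

/-! ### The Mori cone and extremality

By duality with `ℤ^{G(Σ)} → Pic(X)`, a class in `A_1(X)` is the vector `(D_x · C)_x` of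
its intersection numbers, and `A_1(X) = {c ∈ ℤ^{G(Σ)} | ∑ c_x x = 0}`. -/

/-- The class in `A_1(X) ⊆ ℤ^{G(Σ)}` of the relation `∑_{x ∈ P} x - ∑_y b_y y = 0`; for a primitive
relation this is `r(P)`. -/
def relationClass (P : Finset (Fin d → ℤ)) (b : (Fin d → ℤ) →₀ ℕ) : F.gens → ℤ :=
  fun x => (if x.1 ∈ P then 1 else 0) - (b x.1 : ℤ)

/-- `c` is the class of a torus invariant irreducible curve.  Such curves are the orbit closures
`V(T)` of the cones `T` of dimension `d - 1`; if `T ∪ {x}` and `T ∪ {x'}` are the two maximal cones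
containing `T`, then `c = (D_z · V(T))_z` is given by the relation `x + x' + ∑_{z ∈ T} c_z z = 0`. -/
def IsInvariantCurveClass (c : F.gens → ℤ) : Prop :=
  ∃ (T : Finset (Fin d → ℤ)) (x x' : F.gens),
    T.card + 1 = d ∧ x.1 ∉ T ∧ x'.1 ∉ T ∧ x ≠ x' ∧
    insert x.1 T ∈ F.cones ∧ insert x'.1 T ∈ F.cones ∧
    c x = 1 ∧ c x' = 1 ∧ (∀ z : F.gens, z ≠ x → z ≠ x' → z.1 ∉ T → c z = 0) ∧
    ∑ z : F.gens, c z • z.1 = 0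

/-- The Mori cone `NE(X) ⊆ A_1(X) ⊗ ℝ ⊆ ℝ^{G(Σ)}`, generated by the classes of the torus invariant
curves. -/
noncomputable def moriCone : PointedCone ℝ (F.gens → ℝ) :=
  PointedCone.hull ℝ {v | ∃ c : F.gens → ℤ, F.IsInvariantCurveClass c ∧ v = fun x => (c x : ℝ)}

/-- The primitive collection `P` with primitive relation `∑_{x ∈ P} x = ∑_y b_y y` is extremal:
`r(P)` lies in an extremal ray (a one-dimensional face) of `NE(X)`. -/
def IsExtremalPrimitiveRelation (P : Finset (Fin d → ℤ)) (b : (Fin d → ℤ) →₀ ℕ) : Prop :=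
  F.IsPrimitiveRelation P b ∧
    ∃ R : PointedCone ℝ (F.gens → ℝ), R.IsFaceOf F.moriCone ∧
      (∃ v, v ≠ 0 ∧ R = PointedCone.hull ℝ {v}) ∧
      (fun x => (F.relationClass P b x : ℝ)) ∈ R

end SmoothCompleteFan

/-- The relation `∑_{x ∈ P} x = ∑_y b_y y` has the form `x₁ + x₂ + x₃ + x₄ = y₁ + y₂`. -/
def IsTypeFourTwo {d : ℕ} (P : Finset (Fin d → ℤ)) (b : (Fin d → ℤ) →₀ ℕ) : Prop :=
  P.card = 4 ∧ ∃ y₁ y₂, y₁ ≠ y₂ ∧ b = Finsupp.single y₁ 1 + Finsupp.single y₂ 1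

/-- The relation `∑_{x ∈ P} x = ∑_y b_y y` has the form `x₁ + x₂ + x₃ = y₁`. -/
def IsTypeThreeOne {d : ℕ} (P : Finset (Fin d → ℤ)) (b : (Fin d → ℤ) →₀ ℕ) : Prop :=
  P.card = 3 ∧ ∃ y₁, b = Finsupp.single y₁ 1

/-!
The extremal relation found here always has the form `∑_{x ∈ P} x = 0`, which settles the claim.

The argument takes place on the fan polytope, the convex hull of the generators. Each maximal cone
gives a facet of it and a linear functional, its *level*, which is `1` on the vertices of the facet
and less than `1` on the other generators (`IsFano.level_le_zero`). As `-K` is divisible by two, all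
generators have odd level (`HasIndex.odd_level`), so those outside the facet have level at most
`-1`. Comparing the levels of adjacent facets bounds coordinates from below (`exists_neighbor`). In
particular a generator of level `-1` has coordinates at least `-1`, and is the neighbor of the facet
across each wall where its coordinate is `-1` (`repr_of_level_eq_neg_one`).

If `x` and `-x` are both generators, then every facet contains exactly one of them, and exchanging
the two maps facets to facets. Hence the sum of the coefficients away from `±x` is a functional that
is nonnegative on the Mori cone and vanishes only on the ray of `x + (-x) = 0`, which is therefore
extremal (`isExtremalPrimitiveRelation_pair`).

Otherwise a facet is chosen whose cone contains the sum of all generators; the generators outside it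
then have levels adding up to at least `-5`. Without opposite generators, each generator of level
`-1` is the neighbor across at least two of the five walls, so there are at most two such
generators, and at most one of level `-3` or less (`exists_special_facet`). The few configurations
left are excluded by convexity, completeness or the index, except one: `G(Σ)` consists of `e₁, …,
e₅`, `v = -e₁ - e₂ + e₃` and `t = -e₃ - e₄ - e₅` up to order. There `t + e₃ + e₄ + e₅ = 0` is
extremal, because the divisor of `v` is nef and vanishes only on its ray
(`isExtremalPrimitiveRelation_of_bundle`).

Extremality is checked on the classes of the invariant curves, which generate the Mori cone
(`isExtremalPrimitiveRelation_of_weight`).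
-/

namespace SmoothCompleteFan

variable {d : ℕ}

/-! ### Facets of the fan polytope -/

/-- The linear functional with value `1` on every vector of `b`. When `b` generates a maximal cone,
its level set `1` is the hyperplane spanned by the corresponding facet of the fan polytope. -/
noncomputable def level (b : Module.Basis (Fin d) ℤ (Fin d → ℤ)) : Module.Dual ℤ (Fin d → ℤ) :=
  ∑ i, b.coord i

lemma level_apply (b : Module.Basis (Fin d) ℤ (Fin d → ℤ)) (x : Fin d → ℤ) :
    level b x = ∑ i, b.repr x i := by
  simp [level]

@[simp] lemma level_basis (b : Module.Basis (Fin d) ℤ (Fin d → ℤ)) (i : Fin d) :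
    level b (b i) = 1 := by
  simp [level_apply, Finsupp.single_apply]

lemma level_eq_of_basis {b : Module.Basis (Fin d) ℤ (Fin d → ℤ)} {u : Module.Dual ℤ (Fin d → ℤ)}
    (h : ∀ i, u (b i) = 1) : u = level b :=
  b.ext fun i => by simp [h]

/-- The `ℤ`-basis `b` generates a maximal cone of the fan, that is, it lists the vertices of a facet
of the fan polytope in some order. -/
def IsFacetBasis (F : SmoothCompleteFan d) (b : Module.Basis (Fin d) ℤ (Fin d → ℤ)) : Prop :=
  Finset.univ.image b ∈ F.cones

lemma card_image_basis (b : Module.Basis (Fin d) ℤ (Fin d → ℤ)) :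
    (Finset.univ.image b).card = d := by
  rw [Finset.card_image_of_injective _ b.injective, Finset.card_univ, Fintype.card_fin]

variable (F : SmoothCompleteFan d)

lemma mem_gens {x : Fin d → ℤ} : x ∈ F.gens ↔ {x} ∈ F.cones := by
  simp only [gens, Finset.mem_filter, Finset.mem_biUnion, id, and_iff_right_iff_imp]
  exact fun h => ⟨_, h, by simp⟩

variable {F}

lemma mem_gens_of_mem {S : Finset (Fin d → ℤ)} (hS : S ∈ F.cones) {x : Fin d → ℤ} (hx : x ∈ S) :
    x ∈ F.gens :=
  F.mem_gens.2 (F.face_mem S hS _ (by simpa using hx))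

lemma IsFacetBasis.mem_gens {b : Module.Basis (Fin d) ℤ (Fin d → ℤ)} (hb : F.IsFacetBasis b)
    (i : Fin d) : b i ∈ F.gens :=
  mem_gens_of_mem hb (by simp)

lemma exists_subset_image_basis {S : Finset (Fin d → ℤ)} (hS : S ∈ F.cones) :
    ∃ b : Module.Basis (Fin d) ℤ (Fin d → ℤ), S ⊆ Finset.univ.image b := by
  obtain ⟨b, hb⟩ := F.nonsingular S hS
  refine ⟨b, fun x hx => ?_⟩
  obtain ⟨i, rfl⟩ := hb hx
  simp

lemma exists_isFacetBasis {S : Finset (Fin d → ℤ)} (hS : S ∈ F.cones) (hd : S.card = d) :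
    ∃ b, F.IsFacetBasis b ∧ Finset.univ.image b = S := by
  obtain ⟨b, hb⟩ := exists_subset_image_basis hS
  have h : S = Finset.univ.image b :=
    Finset.eq_of_subset_of_card_le hb (by rw [card_image_basis, hd])
  exact ⟨b, by rwa [IsFacetBasis, ← h], h.symm⟩

lemma sum_smul_eq_zero {S : Finset (Fin d → ℤ)} (hS : S ∈ F.cones) {c : (Fin d → ℤ) → ℤ}
    (h : ∑ x ∈ S, c x • x = 0) : ∀ x ∈ S, c x = 0 := by
  obtain ⟨b, hb⟩ := F.nonsingular S hS
  have hli : LinearIndepOn ℤ id (S : Set (Fin d → ℤ)) :=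
    (b.linearIndependent.linearIndepOn_id).mono hb
  exact linearIndepOn_finset_iff.1 hli c h

lemma not_subset_of_sum_eq_zero {S P : Finset (Fin d → ℤ)} (hS : S ∈ F.cones) (hP : P.Nonempty)
    (h : ∑ x ∈ P, x = 0) : ¬ P ⊆ S := by
  intro hPS
  obtain ⟨x, hx⟩ := hP
  have := sum_smul_eq_zero (F.face_mem S hS P hPS) (c := fun _ => 1) (by simpa using h) x hx
  simp at this

/-! ### The facets cover the lattice -/

/-- The coordinates of real vectors with respect to a `ℤ`-basis of the lattice. -/
noncomputable def realCoord (b : Module.Basis (Fin d) ℤ (Fin d → ℤ)) (i : Fin d) :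
    (Fin d → ℝ) →ₗ[ℝ] ℝ :=
  ∑ j, (b.coord i (Pi.single j 1) : ℝ) • LinearMap.proj j

lemma realCoord_latticeToReal (b : Module.Basis (Fin d) ℤ (Fin d → ℤ)) (i : Fin d)
    (x : Fin d → ℤ) : realCoord b i (latticeToReal x) = b.repr x i := by
  have h : b.coord i x = ∑ j, x j * b.coord i (Pi.single j 1) := by
    rw [LinearMap.pi_apply_eq_sum_univ]
    refine Finset.sum_congr rfl fun j _ => ?_
    rw [smul_eq_mul]
    congr 2
    ext k
    simp [Pi.single_apply, eq_comm]
  rw [← Module.Basis.coord_apply, h]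
  simp [realCoord, latticeToReal, mul_comm]

lemma sum_realCoord_smul (b : Module.Basis (Fin d) ℤ (Fin d → ℤ)) (v : Fin d → ℝ) :
    ∑ i, realCoord b i v • latticeToReal (b i) = v := by
  have key : (∑ i, (realCoord b i).smulRight (latticeToReal (b i))) = LinearMap.id := by
    refine (Pi.basisFun ℝ (Fin d)).ext fun j => ?_
    have h1 : Pi.basisFun ℝ (Fin d) j = latticeToReal (Pi.single j 1) := by
      ext k; by_cases h : k = j <;> simp [latticeToReal, h]
    rw [h1, LinearMap.sum_apply]
    simp only [LinearMap.smulRight_apply, realCoord_latticeToReal, LinearMap.id_apply]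
    ext k
    have := congrFun (b.sum_repr (Pi.single j 1)) k
    simp only [Finset.sum_apply, Pi.smul_apply, smul_eq_mul, latticeToReal] at this ⊢
    exact_mod_cast this
  simpa using congrArg (fun f => f v) key

lemma mem_latticeCone_image_basis (b : Module.Basis (Fin d) ℤ (Fin d → ℤ)) (v : Fin d → ℝ) :
    v ∈ latticeCone (Finset.univ.image b) ↔ ∀ i, 0 ≤ realCoord b i v := by
  constructor
  · intro hv i
    refine Submodule.span_induction (p := fun v _ => 0 ≤ realCoord b i v) ?_ ?_ ?_ ?_ hv
    · rintro _ ⟨x, hx, rfl⟩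
      obtain ⟨k, rfl⟩ : ∃ k, b k = x := by simpa using hx
      rw [realCoord_latticeToReal]
      simp only [Module.Basis.repr_self, Finsupp.single_apply]
      split_ifs <;> simp
    · simp
    · intro x y _ _ hx hy
      rw [map_add]; positivity
    · intro a x _ hx
      have : a • x = (a : ℝ) • x := rfl
      rw [this, map_smul]
      exact mul_nonneg a.2 hx
  · intro h
    rw [← sum_realCoord_smul b v]
    refine Submodule.sum_mem _ fun i _ => ?_
    refine PointedCone.smul_mem _ (h i) (PointedCone.subset_hull ⟨b i, by simp, rfl⟩)

/-- The cones of lower dimension lie in a null set, while the union of the maximal cones is closed;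
so the maximal cones alone cover the space. -/
lemma exists_facet_mem_latticeCone (F : SmoothCompleteFan d) (v : Fin d → ℝ) :
    ∃ b, F.IsFacetBasis b ∧ v ∈ latticeCone (Finset.univ.image b) := by
  classical
  set U : Set (Fin d → ℝ) := ⋃ S ∈ F.cones.filter (fun S => S.card = d), (latticeCone S : Set _)
    with hU
  have hclosed : IsClosed U := by
    refine isClosed_biUnion_finset fun S hS => ?_
    rw [Finset.mem_filter] at hS
    obtain ⟨b, -, rfl⟩ := exists_isFacetBasis hS.1 hS.2
    have : (latticeCone (Finset.univ.image b) : Set (Fin d → ℝ))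
        = ⋂ i, {v | 0 ≤ realCoord b i v} := by
      ext v; simp [mem_latticeCone_image_basis]
    rw [this]
    exact isClosed_iInter fun i =>
      isClosed_le continuous_const (LinearMap.continuous_of_finiteDimensional _)
  have hnull : MeasureTheory.volume Uᶜ = 0 := by
    have hsub : Uᶜ ⊆ ⋃ S ∈ F.cones.filter (fun S => S.card ≠ d),
        (Submodule.span ℝ (latticeToReal '' (S : Set (Fin d → ℤ))) : Set (Fin d → ℝ)) := by
      intro w hw
      obtain ⟨S, hS, hwS⟩ := F.complete w
      simp only [Set.mem_iUnion, Finset.mem_filter]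
      refine ⟨S, ⟨hS, fun hd => hw ?_⟩, PointedCone.hull_le_span (R := ℝ) _ hwS⟩
      simp only [hU, Set.mem_iUnion, Finset.mem_filter]
      exact ⟨S, ⟨hS, hd⟩, hwS⟩
    refine MeasureTheory.measure_mono_null hsub
      ((MeasureTheory.measure_biUnion_null_iff (Finset.countable_toSet _)).2 fun S hS => ?_)
    rw [Finset.mem_coe, Finset.mem_filter] at hS
    refine MeasureTheory.Measure.addHaar_submodule _ _ fun htop => ?_
    obtain ⟨b, hb⟩ := exists_subset_image_basis hS.1
    have h1 : S.card < d :=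
      lt_of_le_of_ne ((Finset.card_le_card hb).trans_eq (card_image_basis b)) hS.2
    have h2 := finrank_span_finset_le_card (R := ℝ) (S.image latticeToReal)
    rw [Set.finrank, Finset.coe_image, htop, finrank_top, Module.finrank_fin_fun] at h2
    have := h2.trans Finset.card_image_le
    omega
  have huniv : Uᶜ = ∅ := (hclosed.isOpen_compl.measure_eq_zero_iff MeasureTheory.volume).1 hnull
  have hv : v ∈ U := by
    by_contra h
    exact (huniv ▸ h : v ∈ (∅ : Set _))
  simp only [hU, Set.mem_iUnion, Finset.mem_filter] at hv
  obtain ⟨S, ⟨hS, hd⟩, hvS⟩ := hv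
  obtain ⟨b, hb, rfl⟩ := exists_isFacetBasis hS hd
  exact ⟨b, hb, hvS⟩

/-- Every lattice point is a combination, with natural coefficients, of the vertices of some facet.
-/
lemma exists_facet_repr_nonneg (F : SmoothCompleteFan d) (p : Fin d → ℤ) :
    ∃ b, F.IsFacetBasis b ∧ ∀ i, 0 ≤ b.repr p i := by
  obtain ⟨b, hb, h⟩ := F.exists_facet_mem_latticeCone (latticeToReal p)
  refine ⟨b, hb, fun i => ?_⟩
  have := (mem_latticeCone_image_basis b _).1 h i
  rw [realCoord_latticeToReal] at this
  exact_mod_cast this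

lemma nonneg_of_nonneg_on_gens {f : Module.Dual ℤ (Fin d → ℤ)} (hf : ∀ x ∈ F.gens, 0 ≤ f x)
    (p : Fin d → ℤ) : 0 ≤ f p := by
  obtain ⟨b, hb, h⟩ := F.exists_facet_repr_nonneg p
  rw [← b.sum_repr p, map_sum]
  exact Finset.sum_nonneg fun i _ => by
    rw [map_smul]; exact mul_nonneg (h i) (hf _ (hb.mem_gens i))

/-! ### Levels of generators on a Fano fan of index two -/

lemma IsFano.level_le_zero {b : Module.Basis (Fin d) ℤ (Fin d → ℤ)} (hF : F.IsFano)
    (hb : F.IsFacetBasis b) {x : Fin d → ℤ} (hx : x ∈ F.gens) (h : x ∉ Finset.univ.image b) :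
    level b x ≤ 0 := by
  obtain ⟨m, hm⟩ := hF _ hb (card_image_basis b)
  have : -m = level b := level_eq_of_basis fun i => by
    have := (hm ⟨b i, hb.mem_gens i⟩).1 (by simp)
    simp [this, antiCanonical]
  have h2 := (hm ⟨x, hx⟩).2 h
  rw [← this]
  simp only [antiCanonical, LinearMap.neg_apply] at h2 ⊢
  omega

lemma IsFano.level_le_one {b : Module.Basis (Fin d) ℤ (Fin d → ℤ)} (hF : F.IsFano)
    (hb : F.IsFacetBasis b) {x : Fin d → ℤ} (hx : x ∈ F.gens) : level b x ≤ 1 := by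
  by_cases h : x ∈ Finset.univ.image b
  · obtain ⟨i, rfl⟩ : ∃ i, b i = x := by simpa using h
    simp
  · linarith [hF.level_le_zero hb hx h]

/-- If `-K = 2H`, some character takes odd values on all generators. In a facet basis it agrees
modulo `2` with the level, which is therefore odd on all generators. -/
lemma HasIndex.odd_level (hI : F.HasIndex 2) {b : Module.Basis (Fin d) ℤ (Fin d → ℤ)}
    (hb : F.IsFacetBasis b) {x : Fin d → ℤ} (hx : x ∈ F.gens) : Odd (level b x) := by
  obtain ⟨⟨-, H, hH⟩, -⟩ := hI
  obtain ⟨h, rfl⟩ := Submodule.Quotient.mk_surjective _ H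
  rw [← Submodule.Quotient.mk_smul, Submodule.Quotient.eq] at hH
  obtain ⟨m, hm⟩ := hH
  have hodd : ∀ y ∈ F.gens, ((m y : ℤ) : ZMod 2) = 1 := fun y hy => by
    have h1 : m y = 1 - 2 * h ⟨y, hy⟩ := by
      have := congrFun hm ⟨y, hy⟩
      simpa [principalDivisor, antiCanonical] using this
    rw [h1]
    push_cast
    rw [show (2 : ZMod 2) = 0 from rfl]
    simp
  have h2 : ((m x : ℤ) : ZMod 2) = (level b x : ℤ) := by
    conv_lhs => rw [← b.sum_repr x]
    rw [level_apply]
    simp only [map_sum, map_smul, smul_eq_mul, Int.cast_sum, Int.cast_mul]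
    exact Finset.sum_congr rfl fun i _ => by rw [hodd _ (hb.mem_gens i), mul_one]
  rw [hodd x hx] at h2
  rw [← Int.not_even_iff_odd, ← ZMod.intCast_eq_zero_iff_even, ← h2]
  decide

lemma level_le_neg_one (hF : F.IsFano) (hI : F.HasIndex 2)
    {b : Module.Basis (Fin d) ℤ (Fin d → ℤ)} (hb : F.IsFacetBasis b) {x : Fin d → ℤ}
    (hx : x ∈ F.gens) (h : x ∉ Finset.univ.image b) : level b x ≤ -1 := by
  have h1 := hF.level_le_zero hb hx h
  obtain ⟨k, hk⟩ := hI.odd_level hb hx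
  omega

/-- Among all levels of a lattice point, the greatest is the one of a facet whose cone contains it.
-/
lemma level_le_level_of_repr_nonneg (hF : F.IsFano) {b b' : Module.Basis (Fin d) ℤ (Fin d → ℤ)}
    (hb : F.IsFacetBasis b) (hb' : F.IsFacetBasis b') {p : Fin d → ℤ}
    (hp : ∀ i, 0 ≤ b'.repr p i) : level b p ≤ level b' p := by
  conv_lhs => rw [← b'.sum_repr p]
  rw [level_apply b', map_sum]
  refine Finset.sum_le_sum fun i _ => ?_
  rw [map_smul, smul_eq_mul]
  have := hF.level_le_one hb (hb'.mem_gens i)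
  nlinarith [hp i]

/-- There are finitely many facets, hence finitely many level functionals. -/
lemma exists_level_lower_bound (F : SmoothCompleteFan d) (x : Fin d → ℤ) :
    ∃ K : ℤ, ∀ b, F.IsFacetBasis b → K ≤ level b x := by
  classical
  have hfin : {u : Module.Dual ℤ (Fin d → ℤ) | ∃ b, F.IsFacetBasis b ∧ level b = u}.Finite := by
    let f (S : Finset (Fin d → ℤ)) : Module.Dual ℤ (Fin d → ℤ) :=
      if h : ∃ b : Module.Basis (Fin d) ℤ (Fin d → ℤ), Finset.univ.image b = S
      then level h.choose else 0
    refine (F.cones.finite_toSet.image f).subset ?_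
    rintro _ ⟨b, hb, rfl⟩
    refine ⟨_, hb, ?_⟩
    have h : ∃ b' : Module.Basis (Fin d) ℤ (Fin d → ℤ),
      Finset.univ.image b' = Finset.univ.image b := ⟨b, rfl⟩
    simp only [f, dif_pos h]
    refine level_eq_of_basis fun i => ?_
    have hi : b i ∈ Finset.univ.image h.choose := by rw [h.choose_spec]; simp
    obtain ⟨k, -, hk⟩ := Finset.mem_image.1 hi
    rw [← hk, level_basis]
  obtain ⟨K, hK⟩ := (hfin.image fun u => u x).bddBelow
  exact ⟨K, fun b hb => hK ⟨_, ⟨b, hb, rfl⟩, rfl⟩⟩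

/-- Crossing the wall of a facet opposite to `b i` replaces `b i` by a generator whose `i`-th
coordinate is `-1`. -/
lemma exists_adjacent_facet (hF : F.IsFano) {b : Module.Basis (Fin d) ℤ (Fin d → ℤ)}
    (hb : F.IsFacetBasis b) (i : Fin d) :
    ∃ x ∈ F.gens, b.repr x i = -1 ∧ insert x ((Finset.univ.image b).erase (b i)) ∈ F.cones := by
  classical
  set T := (Finset.univ.image b).erase (b i) with hT
  have hTcard : T.card = d - 1 := by
    rw [hT, Finset.card_erase_of_mem (by simp), card_image_basis]
  have hd : 0 < d := i.pos
  have hTi : ∀ t ∈ T, b.repr t i = 0 := by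
    intro t ht
    obtain ⟨h1, h2⟩ := Finset.mem_erase.1 ht
    obtain ⟨k, -, rfl⟩ := Finset.mem_image.1 h2
    have : k ≠ i := fun h => h1 (by rw [h])
    simp [this]
  have hTl : ∀ t ∈ T, level b t = 1 := by
    intro t ht
    obtain ⟨k, -, rfl⟩ := Finset.mem_image.1 (Finset.mem_of_mem_erase ht)
    simp
  have hTg : ∀ t ∈ T, t ∈ F.gens := fun t ht => mem_gens_of_mem hb (Finset.mem_of_mem_erase ht)
  obtain ⟨K, hK⟩ := F.exists_level_lower_bound (b i)
  -- a lattice point just beyond the relative interior of the wall `T`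
  set N : ℤ := |K| + 2 with hN
  set p : Fin d → ℤ := N • ∑ t ∈ T, t - b i with hp
  obtain ⟨b', hb', hp'⟩ := F.exists_facet_repr_nonneg p
  have hle := level_le_level_of_repr_nonneg hF hb hb' hp'
  have hTsub : T ⊆ Finset.univ.image b' := by
    by_contra hcon
    obtain ⟨t, ht, htb⟩ := Finset.not_subset.1 hcon
    have h1 : level b p = N * T.card - 1 := by
      rw [hp, map_sub, map_smul, map_sum, Finset.sum_congr rfl hTl]; simp
    have h2 : level b' p = N * ∑ t ∈ T, level b' t - level b' (b i) := by
      rw [hp, map_sub, map_smul, map_sum]; simp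
    have h3 : ∑ t ∈ T, level b' t ≤ T.card - 1 := by
      rw [← Finset.add_sum_erase _ _ ht]
      have h4 := hF.level_le_zero hb' (hTg t ht) htb
      have h5 : ∑ t ∈ T.erase t, level b' t ≤ ∑ t ∈ T.erase t, 1 :=
        Finset.sum_le_sum fun s hs => hF.level_le_one hb' (hTg s (Finset.mem_of_mem_erase hs))
      rw [Finset.sum_const, nsmul_eq_mul, mul_one, Finset.card_erase_of_mem ht] at h5
      have := Finset.card_pos.2 ⟨t, ht⟩
      push_cast [Nat.cast_sub (Nat.succ_le_of_lt this)] at h5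
      linarith
    have h6 := hK b' hb'
    rw [h1, h2] at hle
    have h7 : N * ∑ t ∈ T, level b' t ≤ N * (T.card - 1) :=
      mul_le_mul_of_nonneg_left h3 (by positivity)
    have := neg_abs_le K
    linarith
  obtain ⟨x, hx, hxT⟩ : ∃ x, x ∈ Finset.univ.image b' ∧ x ∉ T := by
    by_contra! hcon
    have := Finset.card_le_card hcon
    rw [card_image_basis] at this
    omega
  have hins : insert x T = Finset.univ.image b' := by
    refine Finset.eq_of_subset_of_card_le (Finset.insert_subset hx hTsub) ?_
    rw [card_image_basis, Finset.card_insert_of_notMem hxT]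
    omega
  refine ⟨x, mem_gens_of_mem hb' hx, ?_, hins ▸ hb'⟩
  obtain ⟨k, -, rfl⟩ := Finset.mem_image.1 hx
  have h1 : b.repr p i = -1 := by
    rw [hp, map_sub, map_smul, map_sum, Finsupp.sub_apply, Finsupp.smul_apply,
      Finsupp.finsetSum_apply, Finset.sum_eq_zero hTi]
    simp
  have h2 : b.repr p i = b'.repr p k * b.repr (b' k) i := by
    conv_lhs => rw [← b'.sum_repr p]
    rw [map_sum, Finsupp.finsetSum_apply, Finset.sum_eq_single k]
    · rw [map_smul, Finsupp.smul_apply, smul_eq_mul]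
    · intro j _ hj
      have hjT : b' j ∈ insert (b' k) T := by rw [hins]; simp
      rcases Finset.mem_insert.1 hjT with h | h
      · exact absurd (b'.injective h) hj
      · rw [map_smul, Finsupp.smul_apply, hTi _ h, smul_zero]
    · simp
  rw [h1] at h2
  rcases Int.eq_one_or_neg_one_of_mul_eq_neg_one h2.symm with h | h
  · rw [h] at h2; omega
  · have := hp' k; omega

/-- With `x` the neighbor across the wall opposite to `b i`, the level of the adjacent facet is
`w ↦ level b w + (level b x - 1) * b.repr w i`. It is less than `1` on all generators outside that
facet, which bounds their `i`-th coordinates from below. -/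
lemma exists_neighbor (hF : F.IsFano) (hI : F.HasIndex 2)
    {b : Module.Basis (Fin d) ℤ (Fin d → ℤ)} (hb : F.IsFacetBasis b) (i : Fin d) :
    ∃ x ∈ F.gens, b.repr x i = -1 ∧ insert x ((Finset.univ.image b).erase (b i)) ∈ F.cones ∧
      level b x ≤ -1 ∧ ∀ w ∈ F.gens, w ∉ Finset.univ.image b → w ≠ x →
        level b w - 1 < (1 - level b x) * b.repr w i := by
  classical
  obtain ⟨x, hx, hxi, hcone⟩ := exists_adjacent_facet hF hb i
  have hxb : x ∉ Finset.univ.image b := by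
    intro h
    obtain ⟨k, -, rfl⟩ := Finset.mem_image.1 h
    rw [Module.Basis.repr_self, Finsupp.single_apply] at hxi
    split_ifs at hxi
  refine ⟨x, hx, hxi, hcone, level_le_neg_one hF hI hb hx hxb, fun w hw hwb hwx => ?_⟩
  have hcard : (insert x ((Finset.univ.image b).erase (b i))).card = d := by
    rw [Finset.card_insert_of_notMem fun h => hxb (Finset.mem_of_mem_erase h),
      Finset.card_erase_of_mem (by simp), card_image_basis]
    have := i.pos
    omega
  obtain ⟨b', hb', him⟩ := exists_isFacetBasis hcone hcard
  have h1 : ∀ y ∈ insert x ((Finset.univ.image b).erase (b i)), level b' y = 1 := by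
    intro y hy
    rw [← him] at hy
    obtain ⟨k, -, rfl⟩ := Finset.mem_image.1 hy
    simp
  have h2 : ∀ j, j ≠ i → level b' (b j) = 1 := fun j hj =>
    h1 _ (by simp [b.injective.ne hj])
  have h3 : ∀ y, level b' y = level b y - b.repr y i + b.repr y i * level b' (b i) := by
    intro y
    conv_lhs => rw [← b.sum_repr y]
    rw [level_apply b, map_sum, ← Finset.add_sum_erase _ _ (Finset.mem_univ i),
      ← Finset.add_sum_erase (s := Finset.univ) (fun j => b.repr y j) (Finset.mem_univ i)]
    have : ∑ j ∈ Finset.univ.erase i, level b' (b.repr y j • b j)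
        = ∑ j ∈ Finset.univ.erase i, b.repr y j :=
      Finset.sum_congr rfl fun j hj => by
        rw [map_smul, h2 j (Finset.ne_of_mem_erase hj), smul_eq_mul, mul_one]
    rw [this, map_smul, smul_eq_mul]
    ring
  have h4 : level b' (b i) = level b x := by
    have := h3 x
    rw [h1 x (by simp), hxi] at this
    linarith
  have h5 : level b' w ≤ 0 := by
    refine hF.level_le_zero hb' hw ?_
    rw [him]
    simp only [Finset.mem_insert, Finset.mem_erase, not_or, not_and]
    exact ⟨hwx, fun _ => hwb⟩
  have h6 := h3 w
  rw [h4] at h6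
  linarith

/-- A generator `v` of level `-1` has coordinates at least `-1`, and it is the neighbor of `b`
across each wall where its coordinate equals `-1`. -/
lemma repr_of_level_eq_neg_one (hF : F.IsFano) (hI : F.HasIndex 2)
    {b : Module.Basis (Fin d) ℤ (Fin d → ℤ)} (hb : F.IsFacetBasis b) {v : Fin d → ℤ}
    (hv : v ∈ F.gens) (hl : level b v = -1) (i : Fin d) :
    -1 ≤ b.repr v i ∧ (b.repr v i = -1 →
      insert v ((Finset.univ.image b).erase (b i)) ∈ F.cones ∧
      ∀ w ∈ F.gens, w ∉ Finset.univ.image b → w ≠ v → level b w - 1 < 2 * b.repr w i) := by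
  obtain ⟨x, hx, hxi, hcone, hxl, hw⟩ := exists_neighbor hF hI hb i
  have hvb : v ∉ Finset.univ.image b := by
    intro h
    obtain ⟨k, -, rfl⟩ := Finset.mem_image.1 h
    simp at hl
  by_cases hvx : v = x
  · subst hvx
    refine ⟨hxi.ge, fun _ => ⟨hcone, fun w h1 h2 h3 => ?_⟩⟩
    have := hw w h1 h2 h3
    rwa [hl] at this
  · have h1 := hw v hv hvb hvx
    rw [hl] at h1
    have h2 : -1 < b.repr v i := by
      by_contra! h
      nlinarith
    exact ⟨h2.le, fun h => absurd h h2.ne'⟩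

/-- Two generators that are not opposite to each other lie in a common facet: a facet whose cone
contains their sum gives this sum an even, positive level, which is at most `2`. -/
lemma exists_facet_pair (hF : F.IsFano) (hI : F.HasIndex 2) {x y : Fin d → ℤ} (hx : x ∈ F.gens)
    (hy : y ∈ F.gens) (hxy : x + y ≠ 0) :
    ∃ b, F.IsFacetBasis b ∧ level b x = 1 ∧ level b y = 1 := by
  obtain ⟨b, hb, h⟩ := F.exists_facet_repr_nonneg (x + y)
  refine ⟨b, hb, ?_⟩
  have h0 : level b (x + y) ≠ 0 := by
    intro h0
    rw [level_apply, Finset.sum_eq_zero_iff_of_nonneg fun i _ => h i] at h0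
    refine hxy ?_
    rw [← b.sum_repr (x + y)]
    exact Finset.sum_eq_zero fun i hi => by rw [h0 i hi, zero_smul]
  have h1 : 0 ≤ level b (x + y) := by
    rw [level_apply]; exact Finset.sum_nonneg fun i _ => h i
  rw [map_add] at h0 h1
  have h2 := hF.level_le_one hb hx
  have h3 := hF.level_le_one hb hy
  obtain ⟨k, hk⟩ := hI.odd_level hb hx
  obtain ⟨l, hl⟩ := hI.odd_level hb hy
  omega

/-- Three generators lie in a common facet unless their sum is a generator: a facet whose cone
contains the sum gives it level `1` or `3`. -/
lemma exists_facet_triple (hF : F.IsFano) (hI : F.HasIndex 2) {x y z : Fin d → ℤ}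
    (hx : x ∈ F.gens) (hy : y ∈ F.gens) (hz : z ∈ F.gens) (h : x + y + z ∉ F.gens) :
    ∃ b, F.IsFacetBasis b ∧ level b x = 1 ∧ level b y = 1 ∧ level b z = 1 := by
  obtain ⟨b, hb, hnn⟩ := F.exists_facet_repr_nonneg (x + y + z)
  refine ⟨b, hb, ?_⟩
  have h0 : level b (x + y + z) ≠ 1 := by
    intro h0
    rw [level_apply] at h0
    obtain ⟨i, hi⟩ : ∃ i, b.repr (x + y + z) i ≠ 0 := by
      by_contra! hcon
      rw [Finset.sum_eq_zero fun i _ => hcon i] at h0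
      exact zero_ne_one h0
    rw [← Finset.add_sum_erase _ _ (Finset.mem_univ i)] at h0
    have h1 := Finset.sum_nonneg fun j (_ : j ∈ Finset.univ.erase i) => hnn j
    have h2 := hnn i
    have h3 : ∑ j ∈ Finset.univ.erase i, b.repr (x + y + z) j = 0 := by omega
    rw [Finset.sum_eq_zero_iff_of_nonneg fun i _ => hnn i] at h3
    apply h
    rw [← b.sum_repr (x + y + z), ← Finset.add_sum_erase _ _ (Finset.mem_univ i),
      Finset.sum_eq_zero fun j hj => by rw [h3 j hj, zero_smul],
      show b.repr (x + y + z) i = 1 by omega, one_smul, add_zero]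
    exact hb.mem_gens i
  have h1 : 0 ≤ level b (x + y + z) := by
    rw [level_apply]; exact Finset.sum_nonneg fun i _ => hnn i
  rw [map_add, map_add] at h0 h1
  have h2 := hF.level_le_one hb hx
  have h3 := hF.level_le_one hb hy
  have h4 := hF.level_le_one hb hz
  obtain ⟨k, hk⟩ := hI.odd_level hb hx
  obtain ⟨l, hl⟩ := hI.odd_level hb hy
  obtain ⟨m, hm⟩ := hI.odd_level hb hz
  omega

/-! ### Recognizing extremal relations -/

/-- A primitive relation is extremal if its class is the class of an invariant curve, and a linear
functional vanishes on it and is positive on all other classes of invariant curves. -/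
lemma isExtremalPrimitiveRelation_of_weight {P : Finset (Fin d → ℤ)} {b : (Fin d → ℤ) →₀ ℕ}
    (hPb : F.IsPrimitiveRelation P b) (hr : F.IsInvariantCurveClass (F.relationClass P b))
    (w : F.gens → ℤ) (hw : ∑ g, w g * F.relationClass P b g = 0)
    (hpos : ∀ c, F.IsInvariantCurveClass c → c = F.relationClass P b ∨ 0 < ∑ g, w g * c g) :
    F.IsExtremalPrimitiveRelation P b := by
  classical
  set r : F.gens → ℝ := fun x => (F.relationClass P b x : ℝ) with hrdef
  let ℓ : (F.gens → ℝ) →ₗ[ℝ] ℝ := ∑ g, (w g : ℝ) • LinearMap.proj g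
  have hℓ : ∀ c : F.gens → ℤ, ℓ (fun x => (c x : ℝ)) = ((∑ g, w g * c g : ℤ) : ℝ) := by
    intro c
    simp [ℓ]
  have hr0 : ℓ r = 0 := by rw [hrdef, hℓ, hw, Int.cast_zero]
  have hrmem : r ∈ PointedCone.hull ℝ {r} := PointedCone.subset_hull (Set.mem_singleton r)
  have key : ∀ v ∈ F.moriCone, 0 ≤ ℓ v ∧ (ℓ v = 0 → v ∈ PointedCone.hull ℝ {r}) := by
    intro v hv
    refine Submodule.span_induction
      (p := fun v _ => 0 ≤ ℓ v ∧ (ℓ v = 0 → v ∈ PointedCone.hull ℝ {r})) ?_ ?_ ?_ ?_ hv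
    · rintro _ ⟨c, hc, rfl⟩
      rcases hpos c hc with rfl | h
      · exact ⟨hr0.ge, fun _ => hrmem⟩
      · have h1 : 0 < ℓ (fun x => (c x : ℝ)) := by rw [hℓ]; exact_mod_cast h
        exact ⟨h1.le, fun h2 => absurd h2 h1.ne'⟩
    · exact ⟨by simp, fun _ => Submodule.zero_mem _⟩
    · rintro x y - - ⟨hx, hx'⟩ ⟨hy, hy'⟩
      rw [map_add]
      exact ⟨add_nonneg hx hy, fun h => Submodule.add_mem _ (hx' (by linarith)) (hy' (by linarith))⟩
    · rintro a x - ⟨hx, hx'⟩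
      have h1 : ℓ (a • x) = (a : ℝ) * ℓ x := by
        rw [show a • x = (a : ℝ) • x from rfl, map_smul, smul_eq_mul]
      rw [h1]
      refine ⟨mul_nonneg a.2 hx, fun h => ?_⟩
      rcases mul_eq_zero.1 h with h | h
      · have : a = 0 := Subtype.ext h
        rw [this, zero_smul]
        exact Submodule.zero_mem _
      · exact Submodule.smul_mem _ _ (hx' h)
  refine ⟨hPb, PointedCone.hull ℝ {r}, ⟨?_, ?_⟩, ⟨r, ?_, rfl⟩, hrmem⟩
  · refine Submodule.span_le.2 ?_
    rintro _ rfl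
    exact PointedCone.subset_hull ⟨_, hr, rfl⟩
  · intro x y a hx hy ha hxy
    have hz : ℓ (a • x + y) = 0 := by
      refine Submodule.span_induction (p := fun v _ => ℓ v = 0) ?_ ?_ ?_ ?_ hxy
      · rintro _ rfl; exact hr0
      · simp
      · intro x y _ _ hx hy; rw [map_add, hx, hy, add_zero]
      · intro a x _ hx
        rw [show a • x = (a : ℝ) • x from rfl, map_smul, hx, smul_zero]
    rw [map_add, map_smul, smul_eq_mul] at hz
    have h1 := (key x hx).1
    have h2 := (key y hy).1
    have h3 := mul_nonneg ha.le h1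
    have h4 : a * ℓ x = 0 := by linarith
    exact (key x hx).2 ((mul_eq_zero.1 h4).resolve_left ha.ne')
  · obtain ⟨T, x, x', -, -, -, -, -, -, hx, -⟩ := hr
    intro h0
    have := congrFun h0 x
    simp [hrdef, hx] at this

lemma isPrimitiveRelation_zero {P : Finset (Fin d → ℤ)} (hP : P ⊆ F.gens) (hne : P.Nonempty)
    (hsum : ∑ x ∈ P, x = 0) (h : ∀ p ∈ P, P.erase p ∈ F.cones) : F.IsPrimitiveRelation P 0 := by
  refine ⟨⟨hP, fun hcone => not_subset_of_sum_eq_zero hcone hne hsum subset_rfl, fun Q hQ => ?_⟩,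
    by simpa using F.empty_mem, by simpa using hsum⟩
  obtain ⟨p, hp, hpQ⟩ := Finset.exists_of_ssubset hQ
  exact F.face_mem _ (h p hp) _ fun q hq =>
    Finset.mem_erase.2 ⟨fun h => hpQ (h ▸ hq), hQ.subset hq⟩

lemma relationClass_zero (P : Finset (Fin d → ℤ)) (g : F.gens) :
    F.relationClass P 0 g = if g.1 ∈ P then 1 else 0 := by
  simp [relationClass]

/-- The data of an invariant curve, with its class extended by zero to the whole lattice. -/
lemma IsInvariantCurveClass.exists_extension {c : F.gens → ℤ} (hc : F.IsInvariantCurveClass c) :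
    ∃ (C : (Fin d → ℤ) → ℤ) (T : Finset (Fin d → ℤ)) (a a' : Fin d → ℤ),
      (∀ g : F.gens, C g.1 = c g) ∧ a ∈ F.gens ∧ a' ∈ F.gens ∧ T.card + 1 = d ∧ a ∉ T ∧ a' ∉ T ∧
      a ≠ a' ∧ insert a T ∈ F.cones ∧ insert a' T ∈ F.cones ∧ C a = 1 ∧ C a' = 1 ∧
      (∀ z, z ≠ a → z ≠ a' → z ∉ T → C z = 0) ∧ ∑ z ∈ F.gens, C z • z = 0 := by
  classical
  obtain ⟨T, x, x', h1, h2, h3, h4, h5, h6, h7, h8, h9, h10⟩ := hc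
  refine ⟨fun z => if h : z ∈ F.gens then c ⟨z, h⟩ else 0, T, x, x', fun g => by simp, x.2, x'.2,
    h1, h2, h3, fun h => h4 (Subtype.ext h), h5, h6, by simpa using h7, by simpa using h8,
    fun z hz hz' hzT => ?_, ?_⟩
  · by_cases h : z ∈ F.gens
    · simp only [h, dif_pos]
      exact h9 ⟨z, h⟩ (fun h' => hz (congrArg Subtype.val h'))
        (fun h' => hz' (congrArg Subtype.val h')) hzT
    · simp [h]
  · rw [← Finset.sum_coe_sort, ← h10]
    exact Finset.sum_congr rfl fun g _ => by simp

/-! ### A pair of opposite generators -/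

section Antipodal

variable {x : Fin d → ℤ}

/-- Opposite generators have opposite levels, and outside the facet both would be negative. -/
lemma mem_or_neg_mem_facet (hF : F.IsFano) (hI : F.HasIndex 2) (hx : x ∈ F.gens)
    (hx' : -x ∈ F.gens) {S : Finset (Fin d → ℤ)} (hS : S ∈ F.cones) (hd : S.card = d) :
    x ∈ S ∨ -x ∈ S := by
  obtain ⟨b, hb, rfl⟩ := exists_isFacetBasis hS hd
  by_contra! h
  have h1 := level_le_neg_one hF hI hb hx h.1
  have h2 := level_le_neg_one hF hI hb hx' h.2
  rw [map_neg] at h2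
  omega

lemma insert_neg_erase_mem_cones (hF : F.IsFano) (hI : F.HasIndex 2)
    (hx' : -x ∈ F.gens) {S : Finset (Fin d → ℤ)} (hS : S ∈ F.cones) (hd : S.card = d)
    (hxS : x ∈ S) : insert (-x) (S.erase x) ∈ F.cones := by
  obtain ⟨b, hb, rfl⟩ := exists_isFacetBasis hS hd
  obtain ⟨i, -, rfl⟩ := Finset.mem_image.1 hxS
  exact ((repr_of_level_eq_neg_one hF hI hb hx' (by simp) i).2 (by simp)).1

lemma ne_zero_of_mem_gens (hx : x ∈ F.gens) : x ≠ 0 := by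
  rintro rfl
  exact not_subset_of_sum_eq_zero (F.mem_gens.1 hx) (Finset.singleton_nonempty 0) (by simp)
    subset_rfl

lemma not_mem_and_neg_mem (hx : x ∈ F.gens) {S : Finset (Fin d → ℤ)} (hS : S ∈ F.cones)
    (h : x ∈ S) : -x ∉ S := by
  intro h'
  have hne : x ≠ -x := fun h => ne_zero_of_mem_gens hx (self_eq_neg.1 h)
  refine not_subset_of_sum_eq_zero hS (P := {x, -x}) (by simp) (by simp [Finset.sum_pair hne]) ?_
  simp [Finset.insert_subset_iff, h, h']

/-- If a wall contains `x` and `-x` is a generator, replacing `x` by `-x` gives another wall. The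
sum of the coefficients away from `±x` is the mean of the anticanonical degrees of the two curves.
-/
lemma sum_class_pos_of_mem_wall (hF : F.IsFano) (hI : F.HasIndex 2) (hx : x ∈ F.gens)
    (hx' : -x ∈ F.gens) {C : (Fin d → ℤ) → ℤ} {T : Finset (Fin d → ℤ)} {a a' : Fin d → ℤ}
    (ha' : a' ∈ F.gens) (hT : T.card + 1 = d) (haT : a ∉ T)
    (haT' : a' ∉ T) (haa : a ≠ a') (hcone : insert a T ∈ F.cones) (hcone' : insert a' T ∈ F.cones)
    (hCa : C a = 1) (hCa' : C a' = 1) (hC0 : ∀ z, z ≠ a → z ≠ a' → z ∉ T → C z = 0)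
    (hsum : ∑ z ∈ F.gens, C z • z = 0) (hxT : x ∈ T) :
    0 < ∑ z ∈ F.gens, (if z = x ∨ z = -x then 0 else 1) * C z := by
  classical
  have hax : a ≠ x := fun h => haT (h ▸ hxT)
  have hax' : a ≠ -x := fun h => not_mem_and_neg_mem hx hcone (Finset.mem_insert_of_mem hxT)
    (h ▸ Finset.mem_insert_self _ _)
  have ha'x : a' ≠ x := fun h => haT' (h ▸ hxT)
  have ha'x' : a' ≠ -x := fun h => not_mem_and_neg_mem hx hcone' (Finset.mem_insert_of_mem hxT)
    (h ▸ Finset.mem_insert_self _ _)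
  have hTx' : -x ∉ T := fun h => not_mem_and_neg_mem hx hcone (Finset.mem_insert_of_mem hxT)
    (Finset.mem_insert_of_mem h)
  have hd : (insert a T).card = d := by rw [Finset.card_insert_of_notMem haT, hT]
  have hS2 := insert_neg_erase_mem_cones hF hI hx' hcone hd (Finset.mem_insert_of_mem hxT)
  have hd2 : (insert (-x) ((insert a T).erase x)).card = d := by
    rw [Finset.card_insert_of_notMem, Finset.card_erase_of_mem (Finset.mem_insert_of_mem hxT), hd]
    · omega
    · simp [hTx', hax'.symm]
  have hsupp : ∀ f : (Fin d → ℤ) → ℤ, ∑ z ∈ F.gens, f z * C z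
      = f a + f a' + f x * C x + ∑ z ∈ T.erase x, f z * C z := by
    intro f
    have hsub : insert a (insert a' T) ⊆ F.gens := by
      intro z hz
      rcases Finset.mem_insert.1 hz with rfl | hz
      · exact mem_gens_of_mem hcone (Finset.mem_insert_self _ _)
      · exact mem_gens_of_mem hcone' hz
    rw [← Finset.sum_subset hsub, Finset.sum_insert (by simp [haa, haT]), Finset.sum_insert haT',
      ← Finset.add_sum_erase _ _ hxT, hCa, hCa']
    · ring
    · intro z _ hz
      simp only [Finset.mem_insert, not_or] at hz
      rw [hC0 z hz.1 hz.2.1 hz.2.2, mul_zero]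
  have hlin : ∀ f : Module.Dual ℤ (Fin d → ℤ), ∑ z ∈ F.gens, f z * C z = 0 := by
    intro f
    have := congrArg f hsum
    rw [map_sum, map_zero] at this
    rw [← this]
    exact Finset.sum_congr rfl fun z _ => by rw [map_smul, smul_eq_mul, mul_comm]
  obtain ⟨b₁, hb₁, him₁⟩ := exists_isFacetBasis hcone hd
  obtain ⟨b₂, hb₂, him₂⟩ := exists_isFacetBasis hS2 hd2
  have hl : ∀ {b : Module.Basis (Fin d) ℤ (Fin d → ℤ)} {z}, z ∈ Finset.univ.image b →
      level b z = 1 := by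
    intro b z hz
    obtain ⟨k, -, rfl⟩ := Finset.mem_image.1 hz
    simp
  have e1 := hlin (level b₁)
  have e2 := hlin (level b₂)
  have l1a := hl (b := b₁) (z := a) (by rw [him₁]; simp)
  have l1x := hl (b := b₁) (z := x) (by rw [him₁]; simp [hxT])
  have l2a := hl (b := b₂) (z := a) (by rw [him₂]; simp [hax])
  have l2x := hl (b := b₂) (z := -x) (by rw [him₂]; simp)
  have s1 : ∑ z ∈ T.erase x, level b₁ z * C z = ∑ z ∈ T.erase x, C z :=
    Finset.sum_congr rfl fun z hz => by
      rw [hl (by rw [him₁]; simp [Finset.mem_of_mem_erase hz]), one_mul]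
  have s2 : ∑ z ∈ T.erase x, level b₂ z * C z = ∑ z ∈ T.erase x, C z :=
    Finset.sum_congr rfl fun z hz => by
      rw [hl (by rw [him₂]; simp [Finset.mem_of_mem_erase hz, Finset.ne_of_mem_erase hz]), one_mul]
  have l1a' := level_le_neg_one hF hI hb₁ ha' (by rw [him₁]; simp [haa.symm, haT'])
  have l2a' := level_le_neg_one hF hI hb₂ ha' (by rw [him₂]; simp [haa.symm, haT', ha'x'])
  rw [hsupp, l1a, l1x, s1] at e1
  rw [map_neg] at l2x
  rw [hsupp, l2a, s2, show level b₂ x = -1 by omega] at e2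
  have s3 : ∑ z ∈ T.erase x, (if z = x ∨ z = -x then 0 else 1) * C z = ∑ z ∈ T.erase x, C z :=
    Finset.sum_congr rfl fun z hz => by
      rw [if_neg, one_mul]
      rintro (h | h)
      · exact Finset.ne_of_mem_erase hz h
      · exact hTx' (h ▸ Finset.mem_of_mem_erase hz)
  rw [hsupp (fun z => if z = x ∨ z = -x then 0 else 1), s3, if_neg (by simp [hax, hax']),
    if_neg (by simp [ha'x, ha'x']), if_pos (Or.inl rfl)]
  linarith

/-- A pair of opposite generators is an extremal primitive collection: `X` is a `ℙ¹`-bundle whose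
fibers have class `x + (-x) = 0`. The functional exposing their ray is the sum of the coefficients
away from `±x`. -/
lemma isExtremalPrimitiveRelation_pair (hF : F.IsFano) (hI : F.HasIndex 2) (hx : x ∈ F.gens)
    (hx' : -x ∈ F.gens) : F.IsExtremalPrimitiveRelation {x, -x} 0 := by
  classical
  have hne : x ≠ -x := fun h => ne_zero_of_mem_gens hx (self_eq_neg.1 h)
  have hprim : F.IsPrimitiveRelation {x, -x} 0 := by
    refine isPrimitiveRelation_zero ?_ (by simp) (by simp [Finset.sum_pair hne]) ?_
    · simp [Finset.insert_subset_iff, hx, hx']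
    · intro p hp
      rcases Finset.mem_insert.1 hp with rfl | hp
      · rw [Finset.erase_insert (by simpa using hne)]
        exact F.mem_gens.1 hx'
      · rw [Finset.mem_singleton.1 hp, Finset.pair_comm,
          Finset.erase_insert (by simpa using hne.symm)]
        exact F.mem_gens.1 hx
  -- a facet through `x`
  obtain ⟨b, hb, hnn⟩ := F.exists_facet_repr_nonneg x
  have hxb : x ∈ Finset.univ.image b := by
    by_contra h
    have h1 := level_le_neg_one hF hI hb hx h
    have h2 := Finset.sum_nonneg fun i (_ : i ∈ Finset.univ) => hnn i
    rw [← level_apply] at h2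
    omega
  have hbx' : -x ∉ Finset.univ.image b := not_mem_and_neg_mem hx hb hxb
  have hcurve : F.IsInvariantCurveClass (F.relationClass {x, -x} 0) := by
    refine ⟨(Finset.univ.image b).erase x, ⟨x, hx⟩, ⟨-x, hx'⟩, ?_, by simp,
      fun h => hbx' (Finset.mem_of_mem_erase h), fun h => hne (congrArg Subtype.val h),
      by rwa [Finset.insert_erase hxb],
      insert_neg_erase_mem_cones hF hI hx' hb (card_image_basis b) hxb,
      by simp [relationClass_zero], by simp [relationClass_zero], ?_, ?_⟩
    · rw [Finset.card_erase_add_one hxb, card_image_basis]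
    · intro z hz hz' _
      rw [relationClass_zero, if_neg]
      simp only [Finset.mem_insert, Finset.mem_singleton, not_or]
      exact ⟨fun h => hz (Subtype.ext h), fun h => hz' (Subtype.ext h)⟩
    · simp only [relationClass_zero, ite_smul, one_smul, zero_smul]
      rw [Finset.sum_coe_sort F.gens (fun z => if z ∈ ({x, -x} : Finset _) then z else 0),
        ← Finset.sum_filter, Finset.filter_mem_eq_inter, Finset.inter_eq_right.2 hprim.1.1,
        Finset.sum_pair hne, add_neg_cancel]
  refine isExtremalPrimitiveRelation_of_weight hprim hcurve
    (fun z => if z.1 = x ∨ z.1 = -x then 0 else 1) ?_ ?_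
  · refine Finset.sum_eq_zero fun z _ => ?_
    rw [relationClass_zero]
    by_cases h : z.1 = x ∨ z.1 = -x <;> simp [h]
  · intro c hc
    obtain ⟨C, T, a, a', hCc, ha, ha', hT, haT, haT', haa, hcone, hcone', hCa, hCa', hC0, hsum⟩ :=
      hc.exists_extension
    have hw : ∑ z : F.gens, (if z.1 = x ∨ z.1 = -x then 0 else 1) * c z
        = ∑ z ∈ F.gens, (if z = x ∨ z = -x then 0 else 1) * C z := by
      rw [← Finset.sum_coe_sort F.gens]
      exact Finset.sum_congr rfl fun z _ => by rw [hCc]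
    rw [hw]
    by_cases h1 : x ∈ T
    · exact Or.inr (sum_class_pos_of_mem_wall hF hI hx hx' ha' hT haT haT' haa hcone hcone'
        hCa hCa' hC0 hsum h1)
    by_cases h2 : -x ∈ T
    · right
      have := sum_class_pos_of_mem_wall hF hI hx' (by rwa [neg_neg]) ha' hT haT haT' haa hcone
        hcone' hCa hCa' hC0 hsum h2
      simpa only [neg_neg, or_comm] using this
    left
    have hd : (insert a T).card = d := by rw [Finset.card_insert_of_notMem haT, hT]
    have hd' : (insert a' T).card = d := by rw [Finset.card_insert_of_notMem haT', hT]
    have h3 := mem_or_neg_mem_facet hF hI hx hx' hcone hd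
    have h4 := mem_or_neg_mem_facet hF hI hx hx' hcone' hd'
    simp only [Finset.mem_insert, h1, h2, or_false] at h3 h4
    have haa' : a + a' = 0 := by
      rcases h3 with h3 | h3 <;> rcases h4 with h4 | h4
      · exact absurd (h3.symm.trans h4) haa
      · rw [← h3, ← h4, add_neg_cancel]
      · rw [← h3, ← h4, neg_add_cancel]
      · exact absurd (h3.symm.trans h4) haa
    have hCT : ∀ z ∈ T, C z = 0 := by
      refine sum_smul_eq_zero (F.face_mem _ hcone _ (Finset.subset_insert _ _)) ?_
      have hsub : insert a (insert a' T) ⊆ F.gens := by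
        intro z hz
        rcases Finset.mem_insert.1 hz with rfl | hz
        · exact ha
        · exact mem_gens_of_mem hcone' hz
      rw [← Finset.sum_subset hsub, Finset.sum_insert (by simp [haa, haT]),
        Finset.sum_insert haT', hCa, hCa', one_smul, one_smul, ← add_assoc, haa', zero_add] at hsum
      · exact hsum
      · intro z _ hz
        simp only [Finset.mem_insert, not_or] at hz
        rw [hC0 z hz.1 hz.2.1 hz.2.2, zero_smul]
    have hset : ∀ z, z = a ∨ z = a' ↔ z = x ∨ z = -x := by
      intro z
      rcases h3 with h3 | h3 <;> rcases h4 with h4 | h4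
      · exact absurd (h3.symm.trans h4) haa
      · rw [← h3, ← h4]
      · rw [← h3, ← h4, or_comm]
      · exact absurd (h3.symm.trans h4) haa
    funext z
    rw [relationClass_zero, ← hCc]
    simp only [Finset.mem_insert, Finset.mem_singleton, ← hset]
    by_cases hza : z.1 = a
    · simp [hza, hCa]
    by_cases hza' : z.1 = a'
    · simp [hza', hCa']
    simp only [hza, hza', or_self, if_false]
    by_cases hzT : z.1 ∈ T
    · exact hCT _ hzT
    · exact hC0 _ hza hza' hzT

end Antipodal

/-! ### Projective space and a projective bundle -/

/-- If the only generator outside the facet is `-∑ b i`, then `X` is the projective space, whose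
anticanonical class is divisible by `d + 1`. -/
lemma not_hasIndex_of_gens_subset {i : ℕ} {b : Module.Basis (Fin d) ℤ (Fin d → ℤ)}
    {t : Fin d → ℤ} (hgens : F.gens ⊆ insert t (Finset.univ.image b)) (ht : ∀ i, b.repr t i = -1)
    (hi : i ≤ d) : ¬ F.HasIndex i := by
  classical
  intro hI
  have hmem : d + 1 ∈ {m : ℕ | 1 ≤ m ∧
      ∃ H : F.Pic, (Submodule.Quotient.mk F.antiCanonical : F.Pic) = m • H} := by
    refine ⟨by omega, Submodule.Quotient.mk (fun g => if g.1 = t then 1 else 0), ?_⟩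
    rw [← Submodule.Quotient.mk_smul, Submodule.Quotient.eq]
    refine ⟨level b, funext fun g => ?_⟩
    change level b g.1 = 1 - (d + 1) • (if g.1 = t then (1 : ℤ) else 0)
    split_ifs with h
    · rw [h, level_apply, Finset.sum_congr rfl fun i _ => ht i]
      simp
    · obtain ⟨k, -, hk⟩ := Finset.mem_image.1 ((Finset.mem_insert.1 (hgens g.2)).resolve_left h)
      simp [← hk]
  have := hI.2 hmem
  omega

/-- If the generators outside a facet are `t = -∑_{i ∉ I} b i` and `v = b j - ∑_{i ∈ I} b i` with
`j ∉ I`, then `t + ∑_{i ∉ I} b i = 0` is an extremal primitive relation, the class of a line in a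
fiber of a projective bundle over a projective space. The divisor of `v` is nef, as it is linearly
equivalent to those of the `b i` with `i ∈ I` and these divisors have no common point; it vanishes
exactly on the ray of the relation. -/
lemma isExtremalPrimitiveRelation_of_bundle (hF : F.IsFano) {b : Module.Basis (Fin d) ℤ (Fin d → ℤ)}
    (hb : F.IsFacetBasis b) {v t : Fin d → ℤ}
    (hgens : F.gens = insert v (insert t (Finset.univ.image b)))
    {I : Finset (Fin d)} (hI : I.Nonempty) {j : Fin d} (hj : j ∉ I)
    (hvI : ∀ i ∈ I, b.repr v i = -1) (hvj : b.repr v j = 1)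
    (hv0 : ∀ i ∉ I, i ≠ j → b.repr v i = 0)
    (htI : ∀ i ∈ I, b.repr t i = 0) (htc : ∀ i ∉ I, b.repr t i = -1) :
    F.IsExtremalPrimitiveRelation (insert t (Iᶜ.image b)) 0 := by
  classical
  have hvg : v ∈ F.gens := by rw [hgens]; simp
  have htg : t ∈ F.gens := by rw [hgens]; simp
  have hmem : ∀ z ∈ F.gens, z = v ∨ z = t ∨ z ∈ Finset.univ.image b := fun z hz => by
    rwa [hgens, Finset.mem_insert, Finset.mem_insert] at hz
  have hvt : v ≠ t := by
    rintro rfl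
    have := htc j hj
    omega
  have htb : t ∉ Finset.univ.image b := by
    intro h
    obtain ⟨k, -, rfl⟩ := Finset.mem_image.1 h
    have := htc j hj
    rw [Module.Basis.repr_self, Finsupp.single_apply] at this
    split_ifs at this
  have hvb : v ∉ Finset.univ.image b := by
    intro h
    obtain ⟨k, -, rfl⟩ := Finset.mem_image.1 h
    obtain ⟨i, hi⟩ := hI
    have := hvI i hi
    rw [Module.Basis.repr_self, Finsupp.single_apply] at this
    split_ifs at this
  have htI' : t ∉ Iᶜ.image b := fun h => htb (Finset.image_subset_image (Finset.subset_univ _) h)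
  have hvP : v ∉ insert t (Iᶜ.image b) := by
    simp only [Finset.mem_insert, not_or]
    exact ⟨hvt, fun h => hvb (Finset.image_subset_image (Finset.subset_univ _) h)⟩
  have hadj : ∀ i ∉ I, insert t ((Finset.univ.image b).erase (b i)) ∈ F.cones := by
    intro i hi
    obtain ⟨x, hx, hxi, hcone⟩ := exists_adjacent_facet hF hb i
    rcases hmem x hx with rfl | rfl | hx
    · by_cases hij : i = j
      · subst hij; omega
      · have := hv0 i hi hij; omega
    · exact hcone
    · obtain ⟨k, -, rfl⟩ := Finset.mem_image.1 hx
      rw [Module.Basis.repr_self, Finsupp.single_apply] at hxi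
      split_ifs at hxi
  have hsumP : ∑ z ∈ insert t (Iᶜ.image b), z = 0 := by
    rw [Finset.sum_insert htI', Finset.sum_image b.injective.injOn]
    refine b.ext_elem fun i => ?_
    simp only [map_add, map_sum, Module.Basis.repr_self, Finsupp.add_apply,
      Finsupp.finsetSum_apply, Finsupp.single_apply, Finset.sum_ite_eq', Finset.mem_compl, map_zero,
      Finsupp.zero_apply]
    by_cases hi : i ∈ I
    · simp [hi, htI i hi]
    · simp [hi, htc i hi]
  have hPg : insert t (Iᶜ.image b) ⊆ F.gens := by
    rw [hgens]
    refine (Finset.insert_subset_insert _ (Finset.image_subset_image (Finset.subset_univ _))).trans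
      (Finset.subset_insert _ _)
  have hprim : F.IsPrimitiveRelation (insert t (Iᶜ.image b)) 0 := by
    refine isPrimitiveRelation_zero hPg (by simp) hsumP fun p hp => ?_
    rcases Finset.mem_insert.1 hp with rfl | hp'
    · rw [Finset.erase_insert htI']
      exact F.face_mem _ hb _ (Finset.image_subset_image (Finset.subset_univ _))
    · obtain ⟨i, hi, rfl⟩ := Finset.mem_image.1 hp'
      refine F.face_mem _ (hadj i (Finset.mem_compl.1 hi)) _ ?_
      rw [Finset.erase_insert_of_ne fun h => htI' (by rwa [← h] at hp')]
      exact Finset.insert_subset_insert _ (Finset.erase_subset_erase _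
        (Finset.image_subset_image (Finset.subset_univ _)))
  have hcurve : F.IsInvariantCurveClass (F.relationClass (insert t (Iᶜ.image b)) 0) := by
    refine ⟨(Finset.univ.image b).erase (b j), ⟨b j, hb.mem_gens j⟩, ⟨t, htg⟩, ?_, by simp,
      fun h => htb (Finset.mem_of_mem_erase h), fun h => htb ?_,
      by rwa [Finset.insert_erase (by simp)], hadj j hj,
      by rw [relationClass_zero, if_pos (Finset.mem_insert_of_mem
        (Finset.mem_image_of_mem b (Finset.mem_compl.2 hj)))],
      by simp [relationClass_zero], ?_, ?_⟩
    · rw [Finset.card_erase_add_one (by simp), card_image_basis]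
    · have h' : b j = t := congrArg Subtype.val h
      rw [← h']; simp
    · intro z hz hz' hzT
      rw [relationClass_zero, if_neg]
      rcases hmem z.1 z.2 with h1 | h1 | h1
      · rwa [h1]
      · exact absurd (Subtype.ext h1) hz'
      · exact absurd (Finset.mem_erase.2 ⟨fun h => hz (Subtype.ext h), h1⟩) hzT
    · simp only [relationClass_zero, ite_smul, one_smul, zero_smul]
      rw [Finset.sum_coe_sort F.gens (fun z => if z ∈ insert t (Iᶜ.image b) then z else 0),
        ← Finset.sum_filter, Finset.filter_mem_eq_inter, Finset.inter_eq_right.2 hPg, hsumP]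
  refine isExtremalPrimitiveRelation_of_weight hprim hcurve
    (fun z => if z.1 = v then 1 else 0) ?_ ?_
  · refine Finset.sum_eq_zero fun z _ => ?_
    rw [relationClass_zero]
    by_cases h : z.1 = v
    · simp only [h]
      rw [if_neg hvP, mul_zero]
    · simp [h]
  intro c hc
  obtain ⟨C, T, a, a', hCc, ha, ha', hT, haT, haT', haa, hcone, hcone', hCa, hCa', hC0, hsum⟩ :=
    hc.exists_extension
  have hw : ∑ z : F.gens, (if z.1 = v then 1 else 0) * c z = C v := by
    rw [Finset.sum_eq_single ⟨v, hvg⟩]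
    · simp [← hCc]
    · intro z _ hz
      rw [if_neg fun h => hz (Subtype.ext h), zero_mul]
    · simp
  rw [hw]
  have hcoord : ∀ i, C v * b.repr v i + C t * b.repr t i + C (b i) = 0 := by
    intro i
    have h1 := congrArg (fun y => b.repr y i) hsum
    rw [hgens, Finset.sum_insert (by simp only [Finset.mem_insert, not_or]; exact ⟨hvt, hvb⟩),
      Finset.sum_insert htb, Finset.sum_image b.injective.injOn] at h1
    simpa only [map_add, map_sum, map_smul, Finsupp.add_apply, Finsupp.smul_apply, smul_eq_mul,
      Finsupp.finsetSum_apply, Module.Basis.repr_self, Finsupp.single_apply, mul_ite, mul_one,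
      mul_zero, Finset.sum_ite_eq', Finset.mem_univ, if_true, map_zero, Finsupp.zero_apply,
      ← add_assoc] using h1
  have hCI : ∀ i ∈ I, C (b i) = C v := fun i hi => by
    have := hcoord i
    rw [hvI i hi, htI i hi] at this
    linarith
  have hmemT : ∀ z, C z < 0 → z ∈ T := by
    intro z hz
    by_contra h
    have h1 : z ≠ a := by rintro rfl; omega
    have h2 : z ≠ a' := by rintro rfl; omega
    have := hC0 z h1 h2 h
    omega
  have hnn : 0 ≤ C v := by
    by_contra! hneg
    obtain ⟨b', hb', him⟩ := exists_isFacetBasis hcone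
      (by rw [Finset.card_insert_of_notMem haT, hT])
    have hl : ∀ z ∈ T, level b' z = 1 := by
      intro z hz
      have : z ∈ Finset.univ.image b' := by rw [him]; exact Finset.mem_insert_of_mem hz
      obtain ⟨k, -, rfl⟩ := Finset.mem_image.1 this
      simp
    have hvsum : v + ∑ i ∈ I, b i = b j := by
      refine b.ext_elem fun i => ?_
      simp only [map_add, map_sum, Module.Basis.repr_self, Finsupp.add_apply,
        Finsupp.finsetSum_apply, Finsupp.single_apply, Finset.sum_ite_eq']
      by_cases hi : i ∈ I
      · have : j ≠ i := fun h => hj (h ▸ hi)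
        simp [hi, hvI i hi, this]
      · by_cases hij : j = i
        · subst hij; simp [hi, hvj]
        · simp [hi, hij, hv0 i hi (Ne.symm hij)]
    have h1 := congrArg (level b') hvsum
    rw [map_add, map_sum, hl v (hmemT v hneg), Finset.sum_congr rfl fun i hi =>
      hl (b i) (hmemT _ (by rw [hCI i hi]; exact hneg))] at h1
    have h2 := hF.level_le_one hb' (hb.mem_gens j)
    have h3 := Finset.card_pos.2 hI
    simp only [Finset.sum_const, nsmul_eq_mul, mul_one] at h1
    omega
  rcases hnn.eq_or_lt with h0 | h0
  swap
  · exact Or.inr h0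
  left
  have hCIc : ∀ i ∉ I, C (b i) = C t := fun i hi => by
    have := hcoord i
    rw [← h0, htc i hi] at this
    linarith
  have hCt : C t = 1 := by
    rcases hmem a ha with rfl | rfl | ha
    · omega
    · exact hCa
    · obtain ⟨i, -, rfl⟩ := Finset.mem_image.1 ha
      by_cases hi : i ∈ I
      · rw [hCI i hi] at hCa; omega
      · rwa [hCIc i hi] at hCa
  funext z
  rw [relationClass_zero, ← hCc]
  rcases hmem z.1 z.2 with hz | hz | hz
  · rw [hz, if_neg hvP, ← h0]
  · rw [hz, if_pos (Finset.mem_insert_self _ _), hCt]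
  · obtain ⟨i, -, hi⟩ := Finset.mem_image.1 hz
    rw [← hi]
    have h1 : b i ≠ t := fun h => htb (by rw [← h]; simp)
    by_cases hiI : i ∈ I
    · rw [if_neg, hCI i hiI, ← h0]
      simp [h1, hiI, b.injective.eq_iff]
    · rw [if_pos, hCIc i hiI, hCt]
      simp [hiI, b.injective.eq_iff]

/-! ### The generators at level `-1` -/

/-- The indices of the coordinates of `v` that are equal to `-1`. For a generator of level `-1`
these are the walls of the facet across which `v` is the neighbor. -/
noncomputable def negSupport (b : Module.Basis (Fin d) ℤ (Fin d → ℤ)) (v : Fin d → ℤ) :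
    Finset (Fin d) :=
  Finset.univ.filter fun i => b.repr v i = -1

lemma mem_negSupport {b : Module.Basis (Fin d) ℤ (Fin d → ℤ)} {v : Fin d → ℤ} {i : Fin d} :
    i ∈ negSupport b v ↔ b.repr v i = -1 := by
  simp [negSupport]

lemma exists_eq_one_of_sum_eq_one {ι : Type*} [DecidableEq ι] {s : Finset ι} {f : ι → ℤ}
    (hf : ∀ i ∈ s, 0 ≤ f i) (h : ∑ i ∈ s, f i = 1) :
    ∃ j ∈ s, f j = 1 ∧ ∀ i ∈ s, i ≠ j → f i = 0 := by
  obtain ⟨j, hj, hfj⟩ : ∃ j ∈ s, f j ≠ 0 := by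
    by_contra! hcon
    rw [Finset.sum_eq_zero hcon] at h
    exact zero_ne_one h
  have h1 : ∀ i ∈ s.erase j, 0 ≤ f i := fun i hi => hf i (Finset.mem_of_mem_erase hi)
  rw [← Finset.add_sum_erase _ _ hj] at h
  have h2 := Finset.sum_nonneg h1
  have h3 := hf j hj
  refine ⟨j, hj, by omega, fun i hi hij => ?_⟩
  exact (Finset.sum_eq_zero_iff_of_nonneg h1).1 (by omega) i (Finset.mem_erase.2 ⟨hij, hi⟩)

section

variable {b : Module.Basis (Fin d) ℤ (Fin d → ℤ)} {v w : Fin d → ℤ}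

lemma repr_nonneg_of_notMem_negSupport (hF : F.IsFano) (hI : F.HasIndex 2)
    (hb : F.IsFacetBasis b) (hv : v ∈ F.gens) (hl : level b v = -1) {i : Fin d}
    (hi : i ∉ negSupport b v) : 0 ≤ b.repr v i := by
  have h1 := (repr_of_level_eq_neg_one hF hI hb hv hl i).1
  have h2 : b.repr v i ≠ -1 := fun h => hi (mem_negSupport.2 h)
  omega

lemma sum_compl_negSupport (hl : level b v = -1) :
    ∑ i ∈ (negSupport b v)ᶜ, b.repr v i = (negSupport b v).card - 1 := by
  have h1 := Finset.sum_add_sum_compl (negSupport b v) fun i => b.repr v i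
  rw [← level_apply, hl, Finset.sum_congr rfl fun i hi => mem_negSupport.1 hi] at h1
  simp only [Finset.sum_const, nsmul_eq_mul] at h1
  linarith

/-- With a single coordinate `-1`, the others would be nonnegative with sum zero, and `v` would be
opposite to a vertex of the facet. -/
lemma two_le_card_negSupport (hF : F.IsFano) (hI : F.HasIndex 2)
    (hneg : ∀ x ∈ F.gens, -x ∉ F.gens) (hb : F.IsFacetBasis b) (hv : v ∈ F.gens)
    (hl : level b v = -1) : 2 ≤ (negSupport b v).card := by
  have hnn : ∀ i ∈ (negSupport b v)ᶜ, 0 ≤ b.repr v i := fun i hi =>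
    repr_nonneg_of_notMem_negSupport hF hI hb hv hl (Finset.mem_compl.1 hi)
  have h1 := sum_compl_negSupport hl
  have h2 := Finset.sum_nonneg hnn
  by_contra! hlt
  have h3 : (negSupport b v).card = 1 := by omega
  rw [h3, Nat.cast_one, sub_self, Finset.sum_eq_zero_iff_of_nonneg hnn] at h1
  obtain ⟨i, hi⟩ := Finset.card_eq_one.1 h3
  refine hneg _ (hb.mem_gens i) ?_
  convert hv using 1
  refine b.ext_elem fun k => ?_
  rw [map_neg, Module.Basis.repr_self, Finsupp.neg_apply, Finsupp.single_apply]
  split_ifs with h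
  · subst h
    exact (mem_negSupport.1 (by rw [hi]; simp)).symm
  · rw [h1 k (by rw [hi]; simpa using Ne.symm h), neg_zero]

/-- The neighbor of a facet across a given wall is unique. -/
lemma disjoint_negSupport (hF : F.IsFano) (hI : F.HasIndex 2) (hb : F.IsFacetBasis b)
    (hv : v ∈ F.gens) (hvl : level b v = -1) (hw : w ∈ F.gens) (hwl : level b w = -1)
    (hvw : v ≠ w) : Disjoint (negSupport b v) (negSupport b w) := by
  rw [Finset.disjoint_left]
  intro i hi hi'
  have hwb : w ∉ Finset.univ.image b := by
    intro h
    obtain ⟨k, -, rfl⟩ := Finset.mem_image.1 h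
    simp at hwl
  have := ((repr_of_level_eq_neg_one hF hI hb hv hvl i).2 (mem_negSupport.1 hi)).2 w hw hwb hvw.symm
  rw [hwl, mem_negSupport.1 hi'] at this
  omega

end

/-! ### The classification without opposite generators -/

section

variable {F : SmoothCompleteFan 5} {b : Module.Basis (Fin 5) ℤ (Fin 5 → ℤ)} {v w t : Fin 5 → ℤ}

lemma repr_eq_of_card_eq_two (hF : F.IsFano) (hI : F.HasIndex 2) (hb : F.IsFacetBasis b)
    (hv : v ∈ F.gens) (hl : level b v = -1) (hc : (negSupport b v).card = 2) :
    ∃ j ∉ negSupport b v, b.repr v j = 1 ∧ ∀ i ∉ negSupport b v, i ≠ j → b.repr v i = 0 := by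
  have h1 := sum_compl_negSupport hl
  rw [hc] at h1
  obtain ⟨j, hj, hj1, hj0⟩ := exists_eq_one_of_sum_eq_one (fun i hi =>
    repr_nonneg_of_notMem_negSupport hF hI hb hv hl (Finset.mem_compl.1 hi))
    (h1.trans (by norm_num))
  exact ⟨j, Finset.mem_compl.1 hj, hj1, fun i hi => hj0 i (Finset.mem_compl.2 hi)⟩

/-- Two generators of level `-1` cannot be the only ones outside a facet. Writing `v = b j - b i - b
i'` with the `i`-th coordinate of `w` positive, the sum of the `i`-th and `j`-th coordinates is
nonnegative on all generators, so they lie in a half-space. -/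
lemma false_of_gens_subset_two (hF : F.IsFano) (hI : F.HasIndex 2) (hb : F.IsFacetBasis b)
    (hv : v ∈ F.gens) (hvl : level b v = -1) (hw : w ∈ F.gens) (hwl : level b w = -1)
    (hgens : ∀ x ∈ F.gens, x = v ∨ x = w ∨ x ∈ Finset.univ.image b)
    (hcover : ∀ i, i ∉ negSupport b v → i ∈ negSupport b w)
    (hdisj : Disjoint (negSupport b v) (negSupport b w))
    (hc : (negSupport b v).card = 2) : False := by
  obtain ⟨j, hj, hj1, hj0⟩ := repr_eq_of_card_eq_two hF hI hb hv hvl hc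
  have hcw : (negSupport b w)ᶜ = negSupport b v := by
    ext i
    rw [Finset.mem_compl]
    exact ⟨fun h => by_contra fun h' => h (hcover i h'), fun h => Finset.disjoint_left.1 hdisj h⟩
  have hcard : (negSupport b w).card = 3 := by
    have := Finset.card_compl (negSupport b w)
    have h2 := Finset.card_le_univ (negSupport b w)
    rw [hcw, hc] at this
    simp only [Fintype.card_fin] at this h2
    omega
  have hsw := sum_compl_negSupport hwl
  rw [hcw, hcard] at hsw
  obtain ⟨i, hi, hwi⟩ : ∃ i ∈ negSupport b v, 0 < b.repr w i := by
    by_contra! hcon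
    have := Finset.sum_nonpos hcon
    norm_num at hsw
    omega
  have hij : i ≠ j := fun h => hj (h ▸ hi)
  have hnn := nonneg_of_nonneg_on_gens (F := F) (f := b.coord j + b.coord i) (fun x hx => by
    rw [LinearMap.add_apply, Module.Basis.coord_apply, Module.Basis.coord_apply]
    rcases hgens x hx with rfl | rfl | hx
    · rw [hj1, mem_negSupport.1 hi]; norm_num
    · rw [mem_negSupport.1 (hcover j hj)]; omega
    · obtain ⟨k, -, rfl⟩ := Finset.mem_image.1 hx
      simp only [Module.Basis.repr_self, Finsupp.single_apply]
      split_ifs <;> norm_num) (-b j)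
  simp [hij.symm] at hnn

/-- When the walls `{i, i'}` belong to `v` and the other three to `w`, and all generators sum to
zero, then `v = t + 2 b j` for some `j`. This contradicts convexity, since `t` and `b j` lie in a
common facet. -/
lemma false_of_three_two (hF : F.IsFano) (hI : F.HasIndex 2)
    (hneg : ∀ x ∈ F.gens, -x ∉ F.gens) (hb : F.IsFacetBasis b)
    (hv : v ∈ F.gens) (hvl : level b v = -1) (hwl : level b w = -1)
    (ht : t ∈ F.gens) (hsum : ∀ i, 1 + b.repr v i + b.repr w i + b.repr t i = 0)
    (ht1 : ∀ i, -1 ≤ b.repr t i)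
    (hcover : ∀ i, i ∉ negSupport b v → i ∈ negSupport b w)
    (hdisj : Disjoint (negSupport b v) (negSupport b w))
    (hc : (negSupport b v).card = 2) : False := by
  obtain ⟨j, hj, hj1, hj0⟩ := repr_eq_of_card_eq_two hF hI hb hv hvl hc
  have hcw : (negSupport b w)ᶜ = negSupport b v := by
    ext i
    rw [Finset.mem_compl]
    exact ⟨fun h => by_contra fun h' => h (hcover i h'), fun h => Finset.disjoint_left.1 hdisj h⟩
  have hcard : (negSupport b w).card = 3 := by
    have := Finset.card_compl (negSupport b w)
    have h2 := Finset.card_le_univ (negSupport b w)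
    rw [hcw, hc] at this
    simp only [Fintype.card_fin] at this h2
    omega
  have hsw := sum_compl_negSupport hwl
  rw [hcw, hcard] at hsw
  have hw1 : ∀ i ∈ negSupport b v, b.repr w i ≤ 1 := fun i hi => by
    have h1 := hsum i
    have h2 := ht1 i
    rw [mem_negSupport.1 hi] at h1
    omega
  have hw2 : ∀ i ∈ negSupport b v, 1 - b.repr w i = 0 := by
    rw [← Finset.sum_eq_zero_iff_of_nonneg fun i hi => by linarith [hw1 i hi]]
    rw [Finset.sum_sub_distrib, hsw, Finset.sum_const, hc]
    norm_num
  have hvt : v = t + 2 • b j := by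
    refine b.ext_elem fun i => ?_
    have h1 := hsum i
    rw [map_add, map_nsmul, Module.Basis.repr_self, Finsupp.add_apply, Finsupp.smul_apply,
      Finsupp.single_apply]
    by_cases hi : i ∈ negSupport b v
    · have hij : j ≠ i := fun h => hj (h ▸ hi)
      have := hw2 i hi
      rw [mem_negSupport.1 hi] at h1
      rw [mem_negSupport.1 hi, if_neg hij]
      simp
      omega
    · rw [mem_negSupport.1 (hcover i hi)] at h1
      by_cases hij : j = i
      · subst hij
        simp [hj1] at h1 ⊢
        omega
      · rw [if_neg hij, hj0 i hi (Ne.symm hij)] at *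
        simp
        omega
  obtain ⟨b', hb', h1, h2⟩ := exists_facet_pair hF hI ht (hb.mem_gens j) fun h =>
    hneg _ (hb.mem_gens j) (by rwa [← eq_neg_of_add_eq_zero_left h])
  have h3 := hF.level_le_one hb' hv
  rw [hvt, map_add, map_nsmul, h1, h2] at h3
  norm_num at h3

/-- When `v` and `w` each have two walls and `t` has the remaining one `l`, and all generators sum
to zero, then `t = -b j - b k - b l` and `v = b j - b k - b k'`. So `v + b k' = t + 2 b j + b l`,
which contradicts convexity, since `t`, `b j` and `b l` lie in a common facet. -/
lemma false_of_two_two (hF : F.IsFano) (hI : F.HasIndex 2)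
    (hneg : ∀ x ∈ F.gens, -x ∉ F.gens) (hb : F.IsFacetBasis b)
    (hv : v ∈ F.gens) (hvl : level b v = -1) (hw : w ∈ F.gens) (hwl : level b w = -1)
    (ht : t ∈ F.gens) (hsum : ∀ i, 1 + b.repr v i + b.repr w i + b.repr t i = 0)
    (hcover : ∀ i, i ∉ negSupport b v → i ∉ negSupport b w → b.repr t i = -1)
    (hdisj : Disjoint (negSupport b v) (negSupport b w))
    (hcv : (negSupport b v).card = 2) (hcw : (negSupport b w).card = 2) : False := by
  obtain ⟨j, hj, hj1, hj0⟩ := repr_eq_of_card_eq_two hF hI hb hv hvl hcv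
  obtain ⟨k, hk, hk1, hk0⟩ := repr_eq_of_card_eq_two hF hI hb hw hwl hcw
  obtain ⟨l, hl⟩ : ∃ l, (negSupport b v ∪ negSupport b w)ᶜ = {l} := by
    rw [← Finset.card_eq_one, Finset.card_compl, Finset.card_union_of_disjoint hdisj, hcv, hcw]
    rfl
  have hmem : ∀ i, i ∈ negSupport b v ∨ i ∈ negSupport b w ∨ i = l := by
    intro i
    by_cases h : i ∈ negSupport b v ∪ negSupport b w
    · rcases Finset.mem_union.1 h with h | h
      · exact Or.inl h
      · exact Or.inr (Or.inl h)
    · exact Or.inr (Or.inr (Finset.mem_singleton.1 (hl ▸ Finset.mem_compl.2 h)))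
  have hlv : l ∉ negSupport b v ∧ l ∉ negSupport b w := by
    have : l ∈ (negSupport b v ∪ negSupport b w)ᶜ := by rw [hl]; simp
    simpa only [Finset.mem_compl, Finset.mem_union, not_or] using this
  have htl := hcover l hlv.1 hlv.2
  have hvl0 := repr_nonneg_of_notMem_negSupport hF hI hb hv hvl hlv.1
  have hwl0 := repr_nonneg_of_notMem_negSupport hF hI hb hw hwl hlv.2
  have hsl := hsum l
  have hjl : j ≠ l := by rintro rfl; omega
  have hkl : k ≠ l := by rintro rfl; omega
  have hjw : j ∈ negSupport b w := by
    rcases hmem j with h | h | h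
    exacts [absurd h hj, h, absurd h hjl]
  have hkv : k ∈ negSupport b v := by
    rcases hmem k with h | h | h
    exacts [h, absurd h hk, absurd h hkl]
  have hjk : j ≠ k := fun h => hj (h ▸ hkv)
  have htsum : t + b j + b l = -b k := by
    refine b.ext_elem fun i => ?_
    have h1 := hsum i
    simp only [map_add, map_neg, Module.Basis.repr_self, Finsupp.add_apply, Finsupp.neg_apply,
      Finsupp.single_apply]
    rcases hmem i with h | h | h
    · have hij : j ≠ i := fun h' => hj (h' ▸ h)
      have hil : l ≠ i := fun h' => hlv.1 (h' ▸ h)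
      rw [mem_negSupport.1 h] at h1
      rw [if_neg hij, if_neg hil]
      by_cases hik : k = i
      · subst hik
        rw [if_pos rfl]; omega
      · rw [hk0 i (Finset.disjoint_left.1 hdisj h) (Ne.symm hik)] at h1
        rw [if_neg hik]; omega
    · have hik : k ≠ i := fun h' => hk (h' ▸ h)
      have hil : l ≠ i := fun h' => hlv.2 (h' ▸ h)
      rw [mem_negSupport.1 h] at h1
      rw [if_neg hik, if_neg hil]
      by_cases hij : j = i
      · subst hij
        rw [if_pos rfl]; omega
      · rw [hj0 i (Finset.disjoint_right.1 hdisj h) (Ne.symm hij)] at h1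
        rw [if_neg hij]; omega
    · subst h
      rw [if_neg hjl, if_neg hkl, if_pos rfl]; omega
  obtain ⟨k', hk'⟩ : ∃ k', (negSupport b v).erase k = {k'} := by
    rw [← Finset.card_eq_one, Finset.card_erase_of_mem hkv, hcv]
  have hvsum : v + b k + b k' = b j := by
    have hkk' : k' ∈ (negSupport b v).erase k := by rw [hk']; simp
    obtain ⟨hne, hk'v⟩ := Finset.mem_erase.1 hkk'
    refine b.ext_elem fun i => ?_
    simp only [map_add, Module.Basis.repr_self, Finsupp.add_apply, Finsupp.single_apply]
    by_cases hi : i ∈ negSupport b v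
    · have hij : j ≠ i := fun h' => hj (h' ▸ hi)
      rw [mem_negSupport.1 hi, if_neg hij]
      by_cases hik : k = i
      · subst hik
        rw [if_pos rfl, if_neg hne]; omega
      · have : i ∈ (negSupport b v).erase k := Finset.mem_erase.2 ⟨Ne.symm hik, hi⟩
        rw [hk', Finset.mem_singleton] at this
        rw [if_neg hik, if_pos this.symm]; omega
    · have hik : k ≠ i := fun h' => hi (h' ▸ hkv)
      have hik' : k' ≠ i := fun h' => hi (h' ▸ hk'v)
      rw [if_neg hik, if_neg hik']
      by_cases hij : j = i
      · subst hij
        rw [if_pos rfl, hj1]; omega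
      · rw [if_neg hij, hj0 i hi (Ne.symm hij)]; omega
  obtain ⟨b', hb', h1, h2, h3⟩ := exists_facet_triple hF hI ht (hb.mem_gens j) (hb.mem_gens l)
    (by rw [htsum]; exact hneg _ (hb.mem_gens k))
  have e1 := congrArg (level b') htsum
  have e2 := congrArg (level b') hvsum
  rw [map_add, map_add, map_neg] at e1
  rw [map_add, map_add] at e2
  have h4 := hF.level_le_one hb' hv
  have h5 := hF.level_le_one hb' (hb.mem_gens k')
  omega

/-! ### The special facet -/

/-- A facet whose cone contains the sum of all generators. Its level is nonnegative on that sum, so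
the levels of the generators outside add up to at least `-5`. Here `A` consists of the generators of
level `-1`, of which there are at most two because their negative supports are disjoint, and `B` of
those of lower level. -/
lemma exists_special_facet (hF : F.IsFano) (hI : F.HasIndex 2)
    (hneg : ∀ x ∈ F.gens, -x ∉ F.gens) :
    ∃ (b : Module.Basis (Fin 5) ℤ (Fin 5 → ℤ)) (A B : Finset (Fin 5 → ℤ)), F.IsFacetBasis b ∧
      F.gens = Finset.univ.image b ∪ (A ∪ B) ∧ Disjoint A B ∧
      Disjoint (Finset.univ.image b) (A ∪ B) ∧
      (∀ x ∈ A, level b x = -1) ∧ (∀ x ∈ B, level b x ≤ -3) ∧ A.card ≤ 2 ∧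
      -5 ≤ ∑ x ∈ A, level b x + ∑ x ∈ B, level b x ∧
      ∀ i, 0 ≤ 1 + (∑ x ∈ A, b.repr x i + ∑ x ∈ B, b.repr x i) := by
  classical
  obtain ⟨b, hb, hnn⟩ := F.exists_facet_repr_nonneg (∑ x ∈ F.gens, x)
  set O := F.gens \ Finset.univ.image b with hO
  have hsub : Finset.univ.image b ⊆ F.gens := fun x hx => mem_gens_of_mem hb hx
  have hlO : ∀ x ∈ O, level b x ≤ -1 := fun x hx =>
    level_le_neg_one hF hI hb (Finset.mem_sdiff.1 hx).1 (Finset.mem_sdiff.1 hx).2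
  set A := O.filter fun x => level b x = -1 with hA
  set B := O.filter fun x => ¬ level b x = -1 with hB
  have hAB : A ∪ B = O := Finset.filter_union_filter_not_eq _ _
  have hdAB : Disjoint A B := Finset.disjoint_filter_filter_not _ _ _
  have hAl : ∀ x ∈ A, level b x = -1 := fun x hx => (Finset.mem_filter.1 hx).2
  have hAg : ∀ x ∈ A, x ∈ F.gens := fun x hx =>
    (Finset.mem_sdiff.1 (Finset.mem_filter.1 hx).1).1
  have hcoord : ∀ i, 0 ≤ 1 + (∑ x ∈ A, b.repr x i + ∑ x ∈ B, b.repr x i) := by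
    intro i
    have h1 := hnn i
    rw [← Finset.union_sdiff_of_subset hsub, Finset.sum_union Finset.disjoint_sdiff, ← hO,
      ← hAB, Finset.sum_union hdAB, Finset.sum_image b.injective.injOn] at h1
    simpa [Finsupp.single_apply] using h1
  refine ⟨b, A, B, hb, ?_, hdAB, ?_, hAl, ?_, ?_, ?_, hcoord⟩
  · rw [hAB, hO, Finset.union_sdiff_of_subset hsub]
  · rw [hAB]; exact Finset.disjoint_sdiff
  · intro x hx
    obtain ⟨hxO, hx1⟩ := Finset.mem_filter.1 hx
    obtain ⟨k, hk⟩ := hI.odd_level hb (Finset.mem_sdiff.1 hxO).1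
    have := hlO x hxO
    omega
  · have h1 : (A.biUnion (negSupport b)).card = ∑ x ∈ A, (negSupport b x).card :=
      Finset.card_biUnion fun x hx y hy hxy =>
        disjoint_negSupport hF hI hb (hAg x hx) (hAl x hx) (hAg y hy) (hAl y hy) hxy
    have h2 : A.card • 2 ≤ ∑ x ∈ A, (negSupport b x).card :=
      Finset.card_nsmul_le_sum _ _ _ fun x hx =>
        two_le_card_negSupport hF hI hneg hb (hAg x hx) (hAl x hx)
    have h3 := Finset.card_le_univ (A.biUnion (negSupport b))
    simp only [smul_eq_mul, Fintype.card_fin] at h2 h3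
    omega
  · have h1 := Finset.sum_nonneg fun i (_ : i ∈ Finset.univ) => hcoord i
    rw [Finset.sum_add_distrib, Finset.sum_add_distrib, Finset.sum_comm (t := A),
      Finset.sum_comm (t := B)] at h1
    simp only [← level_apply] at h1
    simp at h1
    linarith

/-- Without opposite generators, `X` is a `ℙ³`-bundle over `ℙ²`, and the line in a fiber gives the
extremal relation. -/
lemma exists_extremal_of_no_opposite (hF : F.IsFano) (hI : F.HasIndex 2)
    (hneg : ∀ x ∈ F.gens, -x ∉ F.gens) : ∃ P, F.IsExtremalPrimitiveRelation P 0 := by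
  classical
  obtain ⟨b, A, B, hb, hgens, hAB, hdO, hAl, hBl, hA2, hlev, hcoord⟩ :=
    exists_special_facet hF hI hneg
  have hmem : ∀ x ∈ F.gens, x ∈ A ∨ x ∈ B ∨ x ∈ Finset.univ.image b := fun x hx => by
    rw [hgens] at hx
    simp only [Finset.mem_union] at hx
    tauto
  have hAg : ∀ x ∈ A, x ∈ F.gens := fun x hx => by rw [hgens]; simp [hx]
  have hBg : ∀ x ∈ B, x ∈ F.gens := fun x hx => by rw [hgens]; simp [hx]
  have hnbr : ∀ i, (∃ x ∈ A, b.repr x i = -1) ∨ ∃ x ∈ B, b.repr x i = -1 := by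
    intro i
    obtain ⟨x, hx, hxi, -⟩ := exists_neighbor hF hI hb i
    rcases hmem x hx with h | h | h
    · exact Or.inl ⟨x, h, hxi⟩
    · exact Or.inr ⟨x, h, hxi⟩
    · obtain ⟨k, -, rfl⟩ := Finset.mem_image.1 h
      rw [Module.Basis.repr_self, Finsupp.single_apply] at hxi
      split_ifs at hxi
  -- `#A + 3 #B ≤ 5`
  have hB1 : B.card ≤ 1 := by
    have h1 : ∑ x ∈ A, level b x = -A.card := by
      rw [Finset.sum_congr rfl hAl]; simp
    have h2 := Finset.sum_le_sum hBl
    rw [Finset.sum_const, nsmul_eq_mul] at h2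
    omega
  have hAt : ∀ v ∈ A, ∀ t ∈ B, level b t = -3 → ∀ i ∈ negSupport b v, -1 ≤ b.repr t i := by
    intro v hv t ht htl i hi
    have htO : t ∉ Finset.univ.image b := fun h =>
      Finset.disjoint_left.1 hdO h (Finset.mem_union_right _ ht)
    have hne : t ≠ v := fun h => Finset.disjoint_left.1 hAB hv (h ▸ ht)
    have := ((repr_of_level_eq_neg_one hF hI hb (hAg v hv) (hAl v hv) i).2
      (mem_negSupport.1 hi)).2 t (hBg t ht) htO hne
    rw [htl] at this
    omega
  have hcardA : A.card = 0 ∨ A.card = 1 ∨ A.card = 2 := by omega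
  have hcardB : B.card = 0 ∨ B.card = 1 := by omega
  rcases hcardA with hA | hA | hA
  -- no generator of level `-1`: projective space, which has index `6`
  · rw [Finset.card_eq_zero] at hA
    subst hA
    rcases hcardB with hB | hB
    · rw [Finset.card_eq_zero] at hB
      subst hB
      simpa using hnbr 0
    · obtain ⟨t, rfl⟩ := Finset.card_eq_one.1 hB
      refine absurd hI (not_hasIndex_of_gens_subset (b := b) (t := t) (fun x hx => ?_)
        (fun i => by simpa using hnbr i) (by norm_num))
      have := hmem x hx
      simpa using this
  -- one generator of level `-1`: the only case that occurs
  · obtain ⟨v, rfl⟩ := Finset.card_eq_one.1 hA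
    have hvl := hAl v (by simp)
    have hvg := hAg v (by simp)
    have hlv := hvl
    rw [level_apply] at hlv
    rcases hcardB with hB | hB
    -- `v` alone would have all coordinates equal to `-1`, hence level `-5`
    · rw [Finset.card_eq_zero] at hB
      subst hB
      rw [Finset.sum_congr rfl fun i _ => by simpa using hnbr i] at hlv
      simp at hlv
    · obtain ⟨t, rfl⟩ := Finset.card_eq_one.1 hB
      have htl : level b t = -3 := by
        have h1 := hBl t (by simp)
        obtain ⟨k, hk⟩ := hI.odd_level hb (hBg t (by simp))
        simp only [Finset.sum_singleton] at hlev
        omega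
      have htc : ∀ i ∉ negSupport b v, b.repr t i = -1 := by
        intro i hi
        have h1 := hnbr i
        simp only [Finset.mem_singleton, exists_eq_left] at h1
        exact h1.resolve_left fun h => hi (mem_negSupport.2 h)
      have htI : ∀ i ∈ negSupport b v, 0 ≤ b.repr t i := by
        intro i hi
        have h1 := hcoord i
        simp only [Finset.sum_singleton, mem_negSupport.1 hi] at h1
        linarith
      have hsum := Finset.sum_add_sum_compl (negSupport b v) fun i => b.repr t i
      rw [← level_apply, htl, Finset.sum_congr (s₁ := (negSupport b v)ᶜ) rfl
        fun i hi => htc i (Finset.mem_compl.1 hi), Finset.sum_const, Finset.card_compl] at hsum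
      have h2 := two_le_card_negSupport hF hI hneg hb hvg hvl
      have h3 := Finset.sum_nonneg htI
      have h4 := Finset.card_le_univ (negSupport b v)
      simp only [Fintype.card_fin, nsmul_eq_mul] at hsum h4
      push_cast [Nat.cast_sub h4] at hsum
      have hc : (negSupport b v).card = 2 := by omega
      rw [hc, Nat.cast_ofNat] at hsum
      have htI0 := (Finset.sum_eq_zero_iff_of_nonneg htI).1 (by linarith)
      obtain ⟨j, hj, hj1, hj0⟩ := repr_eq_of_card_eq_two hF hI hb hvg hvl hc
      refine ⟨_, isExtremalPrimitiveRelation_of_bundle hF hb (v := v) (t := t) ?_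
        (Finset.card_pos.1 (by omega)) hj (fun i hi => mem_negSupport.1 hi) hj1 hj0 htI0 htc⟩
      rw [hgens, Finset.union_comm, Finset.union_assoc]
      rfl
  -- two generators of level `-1`: impossible
  · obtain ⟨v, w, hvw, rfl⟩ := Finset.card_eq_two.1 hA
    exfalso
    have hvl := hAl v (by simp)
    have hwl := hAl w (by simp)
    have hvg := hAg v (by simp)
    have hwg := hAg w (by simp)
    have hdisj := disjoint_negSupport hF hI hb hvg hvl hwg hwl hvw
    have hcv := two_le_card_negSupport hF hI hneg hb hvg hvl
    have hcw := two_le_card_negSupport hF hI hneg hb hwg hwl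
    have hcle := Finset.card_le_univ (negSupport b v ∪ negSupport b w)
    rw [Finset.card_union_of_disjoint hdisj, Fintype.card_fin] at hcle
    have hcover_of_card : (negSupport b v).card + (negSupport b w).card = 5 →
        ∀ i, i ∈ negSupport b v ∨ i ∈ negSupport b w := by
      intro h i
      rw [← Finset.mem_union, Finset.eq_univ_of_card (negSupport b v ∪ negSupport b w)
        (by rw [Finset.card_union_of_disjoint hdisj, h, Fintype.card_fin])]
      exact Finset.mem_univ i
    rcases hcardB with hB | hB
    · rw [Finset.card_eq_zero] at hB
      subst hB
      have hcover : ∀ i, i ∈ negSupport b v ∨ i ∈ negSupport b w := fun i => by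
        simpa [mem_negSupport] using hnbr i
      have hgens' : ∀ x ∈ F.gens, x = v ∨ x = w ∨ x ∈ Finset.univ.image b := fun x hx => by
        have := hmem x hx
        simp only [Finset.mem_insert, Finset.mem_singleton, Finset.notMem_empty, false_or] at this
        tauto
      have h5 : (negSupport b v).card + (negSupport b w).card = 5 := by
        rw [← Finset.card_union_of_disjoint hdisj, Finset.eq_univ_iff_forall.2
          fun i => Finset.mem_union.2 (hcover i), Finset.card_univ, Fintype.card_fin]
      have h6 : (negSupport b v).card = 2 ∨ (negSupport b w).card = 2 := by omega
      rcases h6 with h6 | h6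
      · exact false_of_gens_subset_two hF hI hb hvg hvl hwg hwl hgens'
          (fun i => (hcover i).resolve_left) hdisj h6
      · exact false_of_gens_subset_two hF hI hb hwg hwl hvg hvl
          (fun x hx => by have := hgens' x hx; tauto)
          (fun i => (hcover i).resolve_right) hdisj.symm h6
    · obtain ⟨t, rfl⟩ := Finset.card_eq_one.1 hB
      have htg := hBg t (by simp)
      rw [Finset.sum_pair hvw, Finset.sum_singleton, hvl, hwl] at hlev
      have htl : level b t = -3 := by
        have h1 := hBl t (by simp)
        omega
      -- the sum of all generators has level `5 - 1 - 1 - 3 = 0`, so it is zero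
      have hsum : ∀ i, 1 + b.repr v i + b.repr w i + b.repr t i = 0 := by
        have h1 : ∀ i, 0 ≤ 1 + b.repr v i + b.repr w i + b.repr t i := fun i => by
          have := hcoord i
          rw [Finset.sum_pair hvw, Finset.sum_singleton] at this
          linarith
        have h2 : ∑ i, (1 + b.repr v i + b.repr w i + b.repr t i) = 0 := by
          simp only [Finset.sum_add_distrib, ← level_apply, hvl, hwl, htl]
          simp
        intro i
        exact (Finset.sum_eq_zero_iff_of_nonneg fun i _ => h1 i).1 h2 i (Finset.mem_univ i)
      have htv := hAt v (by simp) t (by simp) htl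
      have htw := hAt w (by simp) t (by simp) htl
      have hcases : ((negSupport b v).card = 2 ∧ (negSupport b w).card = 3) ∨
          ((negSupport b v).card = 3 ∧ (negSupport b w).card = 2) ∨
          ((negSupport b v).card = 2 ∧ (negSupport b w).card = 2) := by omega
      rcases hcases with ⟨h1, h2⟩ | ⟨h1, h2⟩ | ⟨h1, h2⟩
      · have hcover := hcover_of_card (by omega)
        exact false_of_three_two hF hI hneg hb hvg hvl hwl htg hsum
          (fun i => (hcover i).elim (htv i) (htw i)) (fun i => (hcover i).resolve_left) hdisj h1
      · have hcover := hcover_of_card (by omega)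
        exact false_of_three_two hF hI hneg hb hwg hwl hvl htg
          (fun i => by have := hsum i; linarith)
          (fun i => (hcover i).elim (htv i) (htw i)) (fun i => (hcover i).resolve_right)
          hdisj.symm h2
      · refine false_of_two_two hF hI hneg hb hvg hvl hwg hwl htg hsum (fun i hi hi' => ?_)
          hdisj h1 h2
        have := hnbr i
        simp only [Finset.mem_insert, Finset.mem_singleton, exists_eq_left,
          exists_eq_or_imp] at this
        rw [mem_negSupport] at hi hi'
        tauto

end

end SmoothCompleteFan

theorem lemma3p5 (F : SmoothCompleteFan 5) (hFano : F.IsFano) (hIndex : F.HasIndex 2) :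
    ∃ (P : Finset (Fin 5 → ℤ)) (b : (Fin 5 → ℤ) →₀ ℕ),
      F.IsExtremalPrimitiveRelation P b ∧ ¬ IsTypeFourTwo P b ∧ ¬ IsTypeThreeOne P b := by
  obtain ⟨P, hP⟩ : ∃ P, F.IsExtremalPrimitiveRelation P 0 := by
    by_cases h : ∃ x ∈ F.gens, -x ∈ F.gens
    · obtain ⟨x, hx, hx'⟩ := h
      exact ⟨_, SmoothCompleteFan.isExtremalPrimitiveRelation_pair hFano hIndex hx hx'⟩
    · push Not at h
      exact SmoothCompleteFan.exists_extremal_of_no_opposite hFano hIndex h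
  refine ⟨P, 0, hP, ?_, ?_⟩
  · rintro ⟨-, y₁, y₂, -, h⟩
    have := DFunLike.congr_fun h y₁
    simp only [Finsupp.zero_apply, Finsupp.add_apply, Finsupp.single_eq_same] at this
    omega
  · rintro ⟨-, y₁, h⟩
    have := DFunLike.congr_fun h y₁
    simp at this
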